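/- **Notation.** For $S\subset\mathbb C$ let $\bar S$ be its closure in $\mathbb C$ and let $S'$ be the set of those $z\in S$ that lie in the closure of $S\setminus\{z\}$. For $k\ge1$ let $\mathcal M_k(\mathbb C)$ be the space of complex $k\times k$ matrices with the operator norm. Write $\mathrm{spc}(X)$ for the spectrum and $\mu_X$ for the minimal polynomial of $X\in\mathcal M_k(\mathbb C)$. Put $\mathcal D_k(S)=\{X\in\mathcal M_k(\mathbb C): X \text{ is diagonalizable and } \mathrm{spc}(X)\subset S\}$ and $\mathcal M_k^o(S)=\{X\in\mathcal M_k(\mathbb C): \mathrm{spc}(X)\subset S \text{ and every multiple root of } \mu_X \text{ belongs to } S'\}$. *Divided differences.* For $g\colon S\to\mathbb C$ and pairwise distinct $z_1,\dots,z_n\in S$ put $\Delta(z_1)g=g(z_1)$ and $\Delta(z_1,\dots,z_n)g=\dfrac{\Delta(z_2,\dots,z_n)g-\Delta(z_1,\dots,z_{n-1})g}{z_n-z_1}$ for $n>1$. For $n\ge 0$, $g\in DDC^{n}(S)$ means that for every $z\in S'$ the quantity $\Delta(z_1,\dots,z_{n+1})g$ has a finite limit as the tuple $(z_1,\dots,z_{n+1})$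 of pairwise distinct points of $S$ tends to $(z,\dots,z)$. *T-derivatives.* For $n\ge1$, $g\colon S\to\mathbb C$ is $n$ times T-differentiable at $a\in S'$ if $g(z)=\sum_{j=0}^{n}\frac{u_j}{j!}(z-a)^j+\tau_a(z)(z-a)^n$ for all $z\in S$, with complex $u_0,\dots,u_n$ and $\tau_a\colon S\to\mathbb C$ continuous at $a$, $\tau_a(a)=0$; then $g^{(j)}(a):=u_j$ is uniquely determined. It is of class $TC^{n}$ if this holds at every $a\in S'$ and the functions $g',\dots,g^{(n)}$ on $S'$ and $(a,x)\mapsto\tau_a(x)$ on $S'\times S$ are continuous. *Functional calculus.* For any $g\colon S\to\mathbb C$ and $X\in\mathcal D_k(S)$ let $g_{\rm op}(X)=g[X]:=P[X]$ for any polynomial $P$ with $P=g$ on $\mathrm{spc}(X)$. If $g$ is of class $TC^{k-1}$ with $k\ge2$ and $X\in\mathcal M_k^o(S)$, let $g_{\rm op}(X)=g[X]:=P[X]$ for any polynomial $P$ such that for every eigenvalue $\lambda$ of $X$, with multiplicity $p$ as a root of $\mu_X$, one has $P(\lambda)=g(\lambda)$ and $P^{(s)}(\lambda)=g^{(s)}(\lambda)$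 for $1\le s<p$. These do not depend on the choice of $P$. **Proposition.** Let $\Omega\subset\mathbb C$ be an arbitrary nonempty set, $f\colon\Omega\to\mathbb C$ an arbitrary function and $k\ge2$. The following are equivalent: 1. for any $z\in\Omega$ there is a relatively open (in $\mathcal D_k(\Omega)$) neighbourhood of $zI$ on which $f_{\rm op}\colon\mathcal D_k(\Omega)\to\mathcal M_k(\mathbb C)$ is uniformly continuous; 2. every point of $\mathcal D_k(\Omega)$ has a relatively open (in $\mathcal D_k(\Omega)$) neighbourhood on which $f_{\rm op}\colon\mathcal D_k(\Omega)\to\mathcal M_k(\mathbb C)$ is uniformly continuous; 3. $f$ extends to a function $\tilde f\in DDC^{k-1}(\tilde\Omega)$ for some locally compact set $\tilde\Omega$ with $\Omega\subset\tilde\Omega\subset\bar\Omega$. Moreover, whenever $\tilde\Omega$ and $\tilde f$ are as in 3, then $\tilde f$ is of class $TC^{k-1}$ on $\tilde\Omega$ (so that $\tilde f_{\rm op}$ is defined on $\mathcal M_k^o(\tilde\Omega)$) and every point of $\mathcal M_k^o(\tilde\Omega)$ has a relatively open (in $\mathcal M_k^o(\tilde\Omega)$) neighbourhood on which $\tilde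 f_{\rm op}\colon\mathcal M_k^o(\tilde\Omega)\to\mathcal M_k(\mathbb C)$ is uniformly continuous. -/

import Mathlib

open Set Filter Topology Polynomial
open scoped Matrix.Norms.L2Operator

noncomputable section

namespace MatCalc

/-! A function `f : Ω → ℂ` on a set `Ω ⊆ ℂ` is represented by a total function `f : ℂ → ℂ`
accompanied by `Ω`; every notion below depends only on the values of `f` on `Ω`.
Matrices carry the operator norm induced by the Euclidean norm. -/

/-- The set of those points of `Ω` that are cluster points of `Ω`. -/
def clusterPts (Ω : Set ℂ) : Set ℂ := {z | z ∈ Ω ∧ z ∈ closure (Ω \ {z})}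

/-! ### Divided differences -/

/-- The divided difference of `f` at the `n + 1` points `z 0, …, z n` (assumed distinct). -/
def divDiff (f : ℂ → ℂ) : (n : ℕ) → (Fin (n + 1) → ℂ) → ℂ
  | 0, z => f (z 0)
  | n + 1, z =>
      (divDiff f n (fun i => z i.succ) - divDiff f n (fun i => z i.castSucc)) /
        (z (Fin.last (n + 1)) - z 0)

/-- The `n`-tuples of pairwise distinct points of `Ω`. -/
def distinctTuples (n : ℕ) (Ω : Set ℂ) : Set (Fin n → ℂ) :=
  {z | (∀ i, z i ∈ Ω) ∧ Function.Injective z}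

/-- The class `DDC^n(Ω)`: the divided difference, as a function of `n + 1` distinct points of `Ω`,
has a finite limit at `(a, …, a)` for every cluster point `a ∈ Ω` of `Ω`. -/
def IsDDC (n : ℕ) (Ω : Set ℂ) (f : ℂ → ℂ) : Prop :=
  ∀ a ∈ clusterPts Ω, ∃ L : ℂ,
    Tendsto (divDiff f n) (𝓝[distinctTuples (n + 1) Ω] (fun _ => a)) (𝓝 L)

/-! ### T-derivatives -/

/-- `f(z) = ∑_{j ≤ n} u_j / j! (z - a)^j + τ(z) (z - a)^n` on `Ω`, with `τ(a) = 0` and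
`τ : Ω → ℂ` continuous at `a`. -/
def IsTaylorAt (Ω : Set ℂ) (f : ℂ → ℂ) (n : ℕ) (a : ℂ) (u : ℕ → ℂ) (τ : ℂ → ℂ) : Prop :=
  (∀ z ∈ Ω, f z = ∑ j ∈ Finset.range (n + 1), u j / (j.factorial : ℂ) * (z - a) ^ j
      + τ z * (z - a) ^ n) ∧
    τ a = 0 ∧ ContinuousWithinAt τ Ω a

open scoped Classical in
/-- The `j`-th T-derivative `f^{(j)}(a)` at a cluster point `a ∈ Ω`, with `f^{(0)}(a) = f(a)`;
for `j ≥ 1` it is the coefficient `u_j` of a Taylor expansion of order `j`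
(with junk value `0` if there is none). -/
def tDeriv (Ω : Set ℂ) (f : ℂ → ℂ) : ℕ → ℂ → ℂ
  | 0, a => f a
  | j + 1, a =>
      if h : ∃ u : ℕ → ℂ, ∃ τ : ℂ → ℂ, IsTaylorAt Ω f (j + 1) a u τ then h.choose (j + 1) else 0

/-- The class `TC^n`: for `n = 0` continuity; for `n ≥ 1`, `f` is `n` times T-differentiable at
every cluster point, and the T-derivatives on `Ω'` and the remainder
`τ : Ω' × Ω → ℂ` are continuous. -/
def IsTC (n : ℕ) (Ω : Set ℂ) (f : ℂ → ℂ) : Prop :=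
  (n = 0 ∧ ContinuousOn f Ω) ∨
  (1 ≤ n ∧ ∃ τ : ℂ → ℂ → ℂ,
    (∀ a ∈ clusterPts Ω, IsTaylorAt Ω f n a (fun j => tDeriv Ω f j a) (τ a)) ∧
    (∀ j, 1 ≤ j → j ≤ n → ContinuousOn (tDeriv Ω f j) (clusterPts Ω)) ∧
    ContinuousOn (Function.uncurry τ) (clusterPts Ω ×ˢ Ω))

/-! ### Sets of matrices -/

/-- `k × k` complex matrices. -/
abbrev Mat (k : ℕ) : Type := Matrix (Fin k) (Fin k) ℂ

/-- Diagonalizable `k × k` matrices with spectrum in `Ω`. -/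
def diagMats (k : ℕ) (Ω : Set ℂ) : Set (Mat k) :=
  {X | spectrum ℂ X ⊆ Ω ∧
    ∃ (P : Mat k) (d : Fin k → ℂ), IsUnit P ∧ P * X * P⁻¹ = Matrix.diagonal d}

/-- `M_k^o(Ω)`: matrices with spectrum in `Ω` such that every multiple root of the minimal
polynomial is a cluster point of `Ω`. -/
def matsO (k : ℕ) (Ω : Set ℂ) : Set (Mat k) :=
  {X | spectrum ℂ X ⊆ Ω ∧
    ∀ lam : ℂ, 2 ≤ (minpoly ℂ X).rootMultiplicity lam → lam ∈ clusterPts Ω}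

/-! ### The functional calculus -/

/-- `P` is a polynomial that agrees with `f` at every eigenvalue `lam` of `X`, together with the
(T-)derivatives of order less than the multiplicity of `lam` in the minimal polynomial of `X`.
If `X` is diagonalizable this just says that `P = f` on the spectrum of `X`. -/
def Interpolates (Ω : Set ℂ) (f : ℂ → ℂ) {k : ℕ} (X : Mat k) (P : ℂ[X]) : Prop :=
  ∀ lam ∈ spectrum ℂ X, ∀ s < (minpoly ℂ X).rootMultiplicity lam,
    (derivative^[s] P).eval lam = tDeriv Ω f s lam

theorem taylor_coeff_unique {Ω : Set ℂ} {f : ℂ → ℂ} {n : ℕ} {a : ℂ} (ha : a ∈ clusterPts Ω)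
    {u v : ℕ → ℂ} {τ σ : ℂ → ℂ} (hu : IsTaylorAt Ω f n a u τ) (hv : IsTaylorAt Ω f n a v σ) :
    ∀ j ≤ n, u j = v j := by
  obtain ⟨hu1, hu2, hu3⟩ := hu
  obtain ⟨hv1, hv2, hv3⟩ := hv
  intro j
  induction j using Nat.strong_induction_on with
  | _ j ih =>
    intro hj
    set g : ℂ → ℂ := fun z => (∑ i ∈ Finset.range (n + 1), if i < j then 0 else
      (u i - v i) / (i.factorial : ℂ) * (z - a) ^ (i - j)) + (τ z - σ z) * (z - a) ^ (n - j)
      with hg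
    have hgc : ContinuousWithinAt g Ω a := by
      refine ContinuousWithinAt.add (Continuous.continuousWithinAt ?_) ?_
      · refine continuous_finsetSum _ (fun i _ => ?_)
        split_ifs <;> fun_prop
      · exact (hu3.sub hv3).mul (by fun_prop)
    have hga : g a = (u j - v j) / (j.factorial : ℂ) := by
      simp only [hg, hu2, hv2, sub_self, zero_mul, add_zero]
      rw [Finset.sum_eq_single j]
      · simp
      · intro i _ hij
        split_ifs with h
        · rfl
        · rw [zero_pow (by omega), mul_zero]
      · intro h
        exact absurd (Finset.mem_range.2 (by omega)) h
    have hg0 : ∀ z ∈ Ω \ {a}, g z = 0 := by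
      rintro z ⟨hz, hza⟩
      have hne : (z - a) ^ j ≠ 0 := pow_ne_zero _ (sub_ne_zero.2 hza)
      have h1 := (hu1 z hz).symm.trans (hv1 z hz)
      have key : (z - a) ^ j * g z = 0 := by
        simp only [hg, mul_add, Finset.mul_sum]
        have h2 : (z - a) ^ j * ((τ z - σ z) * (z - a) ^ (n - j)) =
            (τ z - σ z) * (z - a) ^ n := by
          rw [mul_left_comm, ← pow_add, Nat.add_sub_cancel' hj]
        have h3 : ∀ i ∈ Finset.range (n + 1), (z - a) ^ j * (if i < j then 0 else
            (u i - v i) / (i.factorial : ℂ) * (z - a) ^ (i - j)) =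
            u i / (i.factorial : ℂ) * (z - a) ^ i - v i / (i.factorial : ℂ) * (z - a) ^ i := by
          intro i _
          split_ifs with h
          · rw [ih i h (by omega)]; ring
          · rw [mul_left_comm, ← pow_add, Nat.add_sub_cancel' (not_lt.1 h)]; ring
        rw [h2, Finset.sum_congr rfl h3, Finset.sum_sub_distrib]
        linear_combination h1
      exact (mul_eq_zero.1 key).resolve_left hne
    have : NeBot (𝓝[Ω \ {a}] a) := mem_closure_iff_nhdsWithin_neBot.1 ha.2
    have hl : Tendsto g (𝓝[Ω \ {a}] a) (𝓝 (g a)) := hgc.mono_left (nhdsWithin_mono _ sdiff_subset)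
    have hl0 : Tendsto g (𝓝[Ω \ {a}] a) (𝓝 0) :=
      tendsto_const_nhds.congr' (eventually_nhdsWithin_of_forall fun z hz => (hg0 z hz).symm)
    have h0 := tendsto_nhds_unique hl hl0
    rw [hga, div_eq_zero_iff] at h0
    exact sub_eq_zero.1 (h0.resolve_right (Nat.cast_ne_zero.2 j.factorial_ne_zero))

theorem IsTaylorAt.mono {Ω : Set ℂ} {f : ℂ → ℂ} {n : ℕ} {a : ℂ} {u : ℕ → ℂ} {τ : ℂ → ℂ}
    (hu : IsTaylorAt Ω f n a u τ) : ∀ j ≤ n, ∃ σ, IsTaylorAt Ω f j a u σ := by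
  intro j hj
  induction hj using Nat.decreasingInduction with
  | self => exact ⟨τ, hu⟩
  | of_succ m hm ih =>
    obtain ⟨σ, h1, h2, h3⟩ := ih
    refine ⟨fun z => u (m + 1) / ((m + 1).factorial : ℂ) * (z - a) + σ z * (z - a), ?_, ?_, ?_⟩
    · intro z hz
      rw [h1 z hz, Finset.sum_range_succ]
      ring
    · simp
    · exact ContinuousWithinAt.add (by fun_prop) (h3.mul (by fun_prop))

/-- Any Taylor expansion of order `n ≥ j` computes the `j`-th T-derivative. -/
theorem tDeriv_eq {Ω : Set ℂ} {f : ℂ → ℂ} {n : ℕ} {a : ℂ} (ha : a ∈ clusterPts Ω)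
    {u : ℕ → ℂ} {τ : ℂ → ℂ} (hu : IsTaylorAt Ω f n a u τ) :
    ∀ j ≤ n, tDeriv Ω f j a = u j := by
  intro j hj
  obtain ⟨σ, hσ⟩ := hu.mono j hj
  cases j with
  | zero =>
    have h := hσ.1 a ha.1
    simpa [tDeriv, hσ.2.1] using h
  | succ m =>
    have hex : ∃ u : ℕ → ℂ, ∃ τ : ℂ → ℂ, IsTaylorAt Ω f (m + 1) a u τ := ⟨u, σ, hσ⟩
    have hd : tDeriv Ω f (m + 1) a = hex.choose (m + 1) := dif_pos hex
    obtain ⟨τ', hτ'⟩ := hex.choose_spec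
    rw [hd]
    exact taylor_coeff_unique ha hτ' hσ _ le_rfl

theorem eval_iterate_derivative_of_dvd {P Q : ℂ[X]} {a : ℂ} {m s : ℕ} (hs : s < m)
    (h : (X - C a) ^ m ∣ P - Q) : (derivative^[s] P).eval a = (derivative^[s] Q).eval a := by
  have h1 : (X - C a) ∣ derivative^[s] (P - Q) :=
    (dvd_pow_self _ (by omega)).trans (pow_sub_dvd_iterate_derivative_of_pow_dvd s h)
  rw [dvd_iff_isRoot, IsRoot.def, iterate_derivative_sub, eval_sub] at h1
  exact sub_eq_zero.1 h1

theorem exists_interpolates (Ω : Set ℂ) (f : ℂ → ℂ) {k : ℕ} (X : Mat k) :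
    ∃ P, Interpolates Ω f X P := by
  classical
  set s : Finset ℂ := (minpoly ℂ X).roots.toFinset
  set m : ℂ → ℕ := fun lam => (minpoly ℂ X).rootMultiplicity lam
  set T : ℂ → ℂ[X] := fun lam => taylor (-lam)
    (∑ i ∈ Finset.range (m lam), C (tDeriv Ω f i lam / (i.factorial : ℂ)) * Polynomial.X ^ i)
  have hT : ∀ lam, ∀ i < m lam, (derivative^[i] (T lam)).eval lam = tDeriv Ω f i lam := by
    intro lam i hi
    have hf : (i.factorial : ℂ) ≠ 0 := Nat.cast_ne_zero.2 i.factorial_ne_zero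
    have h1 : (taylor lam (T lam)).coeff i = tDeriv Ω f i lam / (i.factorial : ℂ) := by
      simp only [T, taylor_taylor, add_neg_cancel, taylor_zero, finsetSum_coeff, coeff_C_mul,
        coeff_X_pow]
      rw [Finset.sum_eq_single i]
      · simp
      · intro j _ hj
        simp [hj.symm]
      · intro h
        exact absurd (Finset.mem_range.2 hi) h
    rw [taylor_coeff] at h1
    rw [← factorial_smul_hasseDeriv, LinearMap.smul_apply, eval_smul, h1, nsmul_eq_mul]
    field_simp
  have hcop : Pairwise (Function.onFun IsCoprime
      (fun lam : s => Ideal.span {(Polynomial.X - C (lam : ℂ)) ^ m lam})) := by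
    intro x y hxy
    rw [Function.onFun, Ideal.isCoprime_span_singleton_iff]
    exact (isCoprime_X_sub_C_of_isUnit_sub
      (sub_ne_zero.2 (fun h => hxy (Subtype.ext h))).isUnit).pow
  obtain ⟨P, hP⟩ := Ideal.exists_forall_sub_mem_ideal hcop (fun lam => T lam)
  refine ⟨P, fun lam _ i hi => ?_⟩
  have hm : minpoly ℂ X ≠ 0 := minpoly.ne_zero (Matrix.isIntegral X)
  have hs : lam ∈ s := by
    rw [Multiset.mem_toFinset, mem_roots hm, ← rootMultiplicity_pos hm]
    omega
  have h1 := Ideal.mem_span_singleton.1 (hP ⟨lam, hs⟩)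
  rw [eval_iterate_derivative_of_dvd hi h1]
  exact hT lam i hi

/-- The matrix `f[X]`, i.e. `P[X]` for an interpolating polynomial `P`. -/
def matFun (Ω : Set ℂ) (f : ℂ → ℂ) {k : ℕ} (X : Mat k) : Mat k :=
  aeval X (exists_interpolates Ω f X).choose

/-- `f[X]` does not depend on the choice of the interpolating polynomial. -/
theorem matFun_eq_aeval {Ω : Set ℂ} {f : ℂ → ℂ} {k : ℕ} {X : Mat k} {P : ℂ[X]}
    (hP : Interpolates Ω f X P) : matFun Ω f X = aeval X P := by
  have hQ := (exists_interpolates Ω f X).choose_spec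
  unfold matFun
  set Q := (exists_interpolates Ω f X).choose
  rw [← sub_eq_zero, ← map_sub]
  refine aeval_eq_zero_of_dvd_aeval_eq_zero (p := minpoly ℂ X) ?_ (minpoly.aeval ℂ X)
  by_cases h0 : Q - P = 0
  · rw [h0]; exact dvd_zero _
  have hm : minpoly ℂ X ≠ 0 := minpoly.ne_zero (Matrix.isIntegral X)
  rw [(IsAlgClosed.splits (minpoly ℂ X)).dvd_iff_roots_le_roots hm h0, Multiset.le_iff_count]
  intro lam
  rw [count_roots, count_roots]
  by_contra! hlt
  have hlt' : (Q - P).rootMultiplicity lam < (minpoly ℂ X).rootMultiplicity lam := hlt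
  have hspec : lam ∈ spectrum ℂ X := by
    have : 0 < (minpoly ℂ X).rootMultiplicity lam := by omega
    have hr := (rootMultiplicity_pos hm).1 this
    exact Matrix.mem_spectrum_of_isRoot_charpoly (hr.dvd (Matrix.minpoly_dvd_charpoly X))
  have := (lt_rootMultiplicity_iff_isRoot_iterate_derivative (n := (Q - P).rootMultiplicity lam)
    h0 (t := lam)).2 (fun m hmle => by
      rw [IsRoot.def, iterate_derivative_sub, eval_sub, hQ lam hspec m (by omega),
        hP lam hspec m (by omega), sub_self])
  exact lt_irrefl _ this

/-- On diagonalizable matrices `f[·]` applies `f` to the eigenvalues. -/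
theorem matFun_conj_diagonal (Ω : Set ℂ) (f : ℂ → ℂ) {k : ℕ} (P : Mat k) (hP : IsUnit P)
    (d : Fin k → ℂ) :
    matFun Ω f (P * Matrix.diagonal d * P⁻¹) =
      P * Matrix.diagonal (fun i => f (d i)) * P⁻¹ := by
  classical
  have hdet : IsUnit P.det := (Matrix.isUnit_iff_isUnit_det P).1 hP
  have hPP : P⁻¹ * P = 1 := Matrix.nonsing_inv_mul P hdet
  have hPP' : P * P⁻¹ = 1 := Matrix.mul_nonsing_inv P hdet
  have hdiag : ∀ Q : ℂ[X], aeval (P * Matrix.diagonal d * P⁻¹) Q =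
      P * Matrix.diagonal (fun i => Q.eval (d i)) * P⁻¹ := by
    intro Q
    induction Q using Polynomial.induction_on' with
    | add p q hp hq =>
      simp only [map_add, hp, hq, eval_add]
      rw [← Matrix.diagonal_add, mul_add, add_mul]
    | monomial n c =>
      have hpow : (P * Matrix.diagonal d * P⁻¹) ^ n = P * Matrix.diagonal (fun i => d i ^ n) * P⁻¹ := by
        induction n with
        | zero => simp [hPP']
        | succ n ih =>
          rw [pow_succ, ih]
          calc P * Matrix.diagonal (fun i => d i ^ n) * P⁻¹ * (P * Matrix.diagonal d * P⁻¹)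
              = P * Matrix.diagonal (fun i => d i ^ n) * (P⁻¹ * P) * Matrix.diagonal d * P⁻¹ := by
                simp only [mul_assoc]
            _ = P * (Matrix.diagonal (fun i => d i ^ n) * Matrix.diagonal d) * P⁻¹ := by
                rw [hPP, mul_one, mul_assoc P]
            _ = _ := by
                rw [Matrix.diagonal_mul_diagonal]
                simp only [pow_succ]
      rw [aeval_monomial, hpow, ← Algebra.smul_def]
      have : Matrix.diagonal (fun i => eval (d i) (monomial n c)) =
          c • Matrix.diagonal (fun i => d i ^ n) := by
        rw [← Matrix.diagonal_smul]
        congr 1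
        ext i
        simp
      rw [this, Matrix.mul_smul, Matrix.smul_mul]
  set W : ℂ[X] := Lagrange.interpolate (Finset.univ.image d) id f
  have hW : ∀ i, W.eval (d i) = f (d i) := fun i =>
    Lagrange.eval_interpolate_at_node (v := id) f (Function.injective_id.injOn)
      (Finset.mem_image_of_mem d (Finset.mem_univ i))
  have hI : Interpolates Ω f (P * Matrix.diagonal d * P⁻¹) W := by
    intro lam _ s hs
    set N : ℂ[X] := ∏ x ∈ Finset.univ.image d, (Polynomial.X - C x) with hN
    have hN0 : N ≠ 0 := (monic_prod_of_monic _ _ (fun x _ => monic_X_sub_C x)).ne_zero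
    have hdvd : minpoly ℂ (P * Matrix.diagonal d * P⁻¹) ∣ N := by
      refine minpoly.dvd _ _ ?_
      rw [hdiag]
      have : (fun i => N.eval (d i)) = fun _ => 0 := by
        ext i
        rw [hN, eval_prod]
        exact Finset.prod_eq_zero (Finset.mem_image_of_mem d (Finset.mem_univ i)) (by simp)
      rw [this]
      simp
    have hle := rootMultiplicity_le_rootMultiplicity_of_dvd hN0 hdvd lam
    rw [← count_roots N, hN, roots_prod_X_sub_C] at hle
    have h1 := Multiset.nodup_iff_count_le_one.1 (Finset.univ.image d).nodup lam
    have hs0 : s = 0 := by omega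
    have hmem : lam ∈ Finset.univ.image d := by
      rw [← Finset.mem_val, ← Multiset.count_pos]
      omega
    obtain ⟨i, -, rfl⟩ := Finset.mem_image.1 hmem
    subst hs0
    simpa [tDeriv] using hW i
  rw [matFun_eq_aeval hI, hdiag]
  simp only [hW]

/-- `x ∈ S` has a neighbourhood, relatively open in `S`, on which `G` is uniformly continuous. -/
def UnifContNear {E F : Type*} [UniformSpace E] [UniformSpace F] (G : E → F) (S : Set E) (x : E) :
    Prop :=
  ∃ V : Set E, IsOpen V ∧ x ∈ V ∧ UniformContinuousOn G (V ∩ S)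

end MatCalc

end

open MatCalc

noncomputable section

namespace MatCalc

/-! ### Divided differences and interpolation at distinct nodes -/

/-! Write `k = n + 1`. The link between matrices and divided differences is `matFun_bidiag_apply`:
for distinct nodes `w` and superdiagonal `e ≠ 0`, the upper right entry of `f` of the bidiagonal
matrix is `e ^ n` times the divided difference of order `n` at `w`.

From 1 to 3: near a scalar matrix, uniform continuity of the calculus makes `f` and its divided
difference of order `n` uniformly continuous near `z` and `(z, …, z)`. So `f` extends continuously
to the part of `closure Ω` covered by small balls, a locally closed set, and the divided difference
has limits on the diagonal there (`exists_isDDC_extension`).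

From 3 to 2, and the supplement: existence of diagonal limits passes to lower orders
(`IsDDC.of_succ`), and divided differences then extend continuously to all tuples whose repeated
entries are cluster points. Newton's formula with these extended values solves the Hermite problem
posed by T-derivatives, so `f[Y]` is the Newton polynomial of `w` at `Y` whenever `∏ (X - w i)`
annihilates `Y` (`matFun_eq_aeval_newton`). This expression is jointly continuous in `Y` and `w`.
The pairs `(Y, w)` with `Y` and `w` in suitable compact sets form a compact set, so the calculus is
continuous, hence uniformly continuous, on its projection (`IsDDC.unifContNear`). Diagonalizable
matrices are a special case. -/

theorem exists_natDegree_le_eval_eq (f : ℂ → ℂ) {m : ℕ} {w : Fin (m + 1) → ℂ}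
    (hw : Function.Injective w) : ∃ p : ℂ[X], p.natDegree ≤ m ∧ ∀ i, p.eval (w i) = f (w i) := by
  refine ⟨Lagrange.interpolate Finset.univ w (fun i => f (w i)), ?_, fun i => ?_⟩
  · have := Lagrange.degree_interpolate_le (s := Finset.univ) (v := w) (fun i => f (w i)) hw.injOn
    exact natDegree_le_of_degree_le (by simpa using this)
  · exact Lagrange.eval_interpolate_at_node (fun i => f (w i)) hw.injOn (Finset.mem_univ i)

theorem coeff_eq_divDiff (f : ℂ → ℂ) : ∀ (m : ℕ) (w : Fin (m + 1) → ℂ), Function.Injective w →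
    ∀ p : ℂ[X], p.natDegree ≤ m → (∀ i, p.eval (w i) = f (w i)) → p.coeff m = divDiff f m w := by
  intro m
  induction m with
  | zero =>
    intro w _ p hp hw
    rw [eq_C_of_natDegree_le_zero hp] at hw ⊢
    simpa [divDiff] using hw 0
  | succ m ih =>
    intro w hw p hp hpw
    have hne : w (Fin.last (m + 1)) - w 0 ≠ 0 :=
      sub_ne_zero.2 fun h => by simpa using congrArg Fin.val (hw h)
    obtain ⟨q, hq, hqw⟩ := exists_natDegree_le_eval_eq f (m := m)
      (w := fun i => w i.castSucc) (hw.comp (Fin.castSucc_injective _))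
    obtain ⟨r, hr, hrw⟩ := exists_natDegree_le_eval_eq f (m := m)
      (w := fun i => w i.succ) (hw.comp (Fin.succ_injective _))
    have hq' := ih (fun i => w i.castSucc) (hw.comp (Fin.castSucc_injective _)) q hq hqw
    have hr' := ih (fun i => w i.succ) (hw.comp (Fin.succ_injective _)) r hr hrw
    -- The Neville–Aitken identity: both sides have degree at most `m + 1` and agree at all `m + 2`
    -- nodes. At an end node one factor vanishes; at the others `q` and `r` both equal `f`.
    have hpoly : C (w (Fin.last (m + 1)) - w 0) * p =
        (X - C (w 0)) * r - (X - C (w (Fin.last (m + 1)))) * q := by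
      refine eq_of_degrees_lt_of_eval_index_eq (s := Finset.univ) (v := w) hw.injOn ?_ ?_ ?_
      · refine (degree_le_of_natDegree_le (n := m + 1) ?_).trans_lt (by simp; norm_cast; omega)
        exact (natDegree_C_mul_le _ _).trans hp
      · refine (degree_le_of_natDegree_le (n := m + 1) ?_).trans_lt (by simp; norm_cast; omega)
        refine (natDegree_sub_le _ _).trans (max_le ?_ ?_)
        all_goals exact natDegree_mul_le.trans (by rw [natDegree_X_sub_C]; omega)
      · intro i _
        simp only [eval_mul, eval_sub, eval_X, eval_C, hpw]
        rcases Fin.eq_zero_or_eq_succ i with rfl | ⟨j, rfl⟩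
        · have := hqw 0
          simp only [Fin.castSucc_zero] at this
          rw [this]; ring
        · rcases Fin.eq_castSucc_or_eq_last j.succ with ⟨l, hl⟩ | hl
          · have h1 := hqw l
            have h2 := hrw j
            rw [← hl] at h1
            rw [h1, h2]; ring
          · have h2 := hrw j
            rw [h2, hl]; ring
    have hcoeff := congrArg (fun P : ℂ[X] => P.coeff (m + 1)) hpoly
    simp only [coeff_C_mul, coeff_sub, sub_mul, coeff_X_mul, coeff_C_mul,
      coeff_eq_zero_of_natDegree_lt (Nat.lt_succ_of_le hq),
      coeff_eq_zero_of_natDegree_lt (Nat.lt_succ_of_le hr), hq', hr'] at hcoeff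
    rw [divDiff, eq_div_iff hne]
    linear_combination hcoeff

/-- The recursion hides the symmetry; the leading coefficient of the interpolating polynomial does
not see the order of the nodes. -/
theorem divDiff_comp_perm (f : ℂ → ℂ) {m : ℕ} {w : Fin (m + 1) → ℂ} (hw : Function.Injective w)
    (σ : Equiv.Perm (Fin (m + 1))) : divDiff f m (w ∘ σ) = divDiff f m w := by
  obtain ⟨p, hdeg, hev⟩ := exists_natDegree_le_eval_eq f hw
  rw [← coeff_eq_divDiff f m w hw p hdeg hev,
    ← coeff_eq_divDiff f m _ (hw.comp σ.injective) p hdeg fun i => hev (σ i)]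

/-- The Newton form of the (Hermite) interpolation polynomial with nodes `w 0, …, w m` and
coefficients given by the (generalized) divided differences `F`. -/
def newton (F : (n : ℕ) → (Fin (n + 1) → ℂ) → ℂ) : (m : ℕ) → (Fin (m + 1) → ℂ) → ℂ[X]
  | 0, w => C (F 0 w)
  | m + 1, w => newton F m (fun i => w i.castSucc) +
      C (F (m + 1) w) * ∏ i : Fin (m + 1), (X - C (w i.castSucc))

theorem natDegree_newton_le (F : (n : ℕ) → (Fin (n + 1) → ℂ) → ℂ) :
    ∀ (m : ℕ) (w : Fin (m + 1) → ℂ), (newton F m w).natDegree ≤ m := by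
  intro m
  induction m with
  | zero => intro w; simp [newton]
  | succ m ih =>
    intro w
    refine natDegree_add_le_of_degree_le ((ih _).trans (Nat.le_succ m)) ?_
    refine (natDegree_C_mul_le _ _).trans ?_
    rw [natDegree_prod_of_monic _ _ fun i _ => monic_X_sub_C _]
    simp

theorem eval_newton_node_of_injective (f : ℂ → ℂ) : ∀ (m : ℕ) (w : Fin (m + 1) → ℂ),
    Function.Injective w → ∀ i, (newton (divDiff f) m w).eval (w i) = f (w i) := by
  intro m
  induction m with
  | zero =>
    intro w _ i
    simp [newton, divDiff, Fin.fin_one_eq_zero i]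
  | succ m ih =>
    intro w hw i
    obtain ⟨p, hdeg, hev⟩ := exists_natDegree_le_eval_eq f hw
    have hmon : (∏ i : Fin (m + 1), (X - C (w i.castSucc))).Monic :=
      monic_prod_of_monic _ _ fun i _ => monic_X_sub_C _
    have hpd : (∏ i : Fin (m + 1), (X - C (w i.castSucc))).natDegree = m + 1 := by
      rw [natDegree_prod_of_monic _ _ fun i _ => monic_X_sub_C _]
      simp
    have hcoe := coeff_eq_divDiff f (m + 1) w hw p hdeg hev
    suffices h : p = newton (divDiff f) (m + 1) w by rw [← h]; exact hev i
    -- The leading coefficients cancel, so the difference has degree at most `m`, and it vanishes at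
    -- the first `m + 1` nodes.
    refine eq_of_degree_sub_lt_of_eval_index_eq (s := Finset.univ)
      (v := fun i : Fin (m + 1) => w i.castSucc)
      (hw.comp (Fin.castSucc_injective _)).injOn ?_ ?_
    · rw [Finset.card_univ, Fintype.card_fin, degree_lt_iff_coeff_zero]
      intro l hl
      rcases hl.eq_or_lt with rfl | hl
      · have h1 : (newton (divDiff f) m (fun i => w i.castSucc)).coeff (m + 1) = 0 :=
          coeff_eq_zero_of_natDegree_lt (Nat.lt_succ_of_le (natDegree_newton_le _ _ _))
        have h2 := hmon.coeff_natDegree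
        rw [hpd] at h2
        rw [coeff_sub, newton, coeff_add, coeff_C_mul, h1, h2, hcoe]
        ring
      · refine coeff_eq_zero_of_natDegree_lt (lt_of_le_of_lt ?_ hl)
        exact (natDegree_sub_le_of_le hdeg (natDegree_newton_le _ _ _)).trans (by simp)
    · intro i _
      rw [hev, newton, eval_add, ih (fun i => w i.castSucc) (hw.comp (Fin.castSucc_injective _)) i, eval_mul,
        eval_prod, Finset.prod_eq_zero (Finset.mem_univ i) (by simp)]
      ring

theorem newton_comp_perm_of_injective (f : ℂ → ℂ) {m : ℕ} {w : Fin (m + 1) → ℂ}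
    (hw : Function.Injective w) (σ : Equiv.Perm (Fin (m + 1))) :
    newton (divDiff f) m (w ∘ σ) = newton (divDiff f) m w := by
  have hd : ∀ v : Fin (m + 1) → ℂ, (newton (divDiff f) m v).degree <
      (Finset.univ : Finset (Fin (m + 1))).card := fun v =>
    (degree_le_of_natDegree_le (natDegree_newton_le _ _ _)).trans_lt
      (by simp; norm_cast; omega)
  refine eq_of_degrees_lt_of_eval_index_eq (s := Finset.univ) (v := w)
    hw.injOn (hd _) (hd _) fun i _ => ?_
  rw [eval_newton_node_of_injective f m w hw]
  have := eval_newton_node_of_injective f m _ (hw.comp σ.injective) (σ.symm i)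
  simpa using this

theorem continuous_aeval_prod_X_sub_C {A : Type*} [Ring A] [Algebra ℂ A] [TopologicalSpace A]
    [IsTopologicalRing A] [ContinuousSMul ℂ A] (l : ℕ) :
    Continuous fun q : A × (Fin l → ℂ) => aeval q.1 (∏ i : Fin l, (X - C (q.2 i))) := by
  induction l with
  | zero => simpa using continuous_const
  | succ l ih =>
    simp only [Fin.prod_univ_castSucc, map_mul, map_sub, aeval_X, aeval_C,
      Algebra.algebraMap_eq_smul_one]
    refine Continuous.mul (ih.comp (continuous_fst.prodMk
      (continuous_pi fun i => (continuous_apply _).comp continuous_snd))) ?_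
    fun_prop

/-- Evaluation of Newton polynomials in a topological algebra is continuous in the nodes. -/
theorem continuousOn_aeval_newton {A : Type*} [Ring A] [Algebra ℂ A] [TopologicalSpace A]
    [IsTopologicalRing A] [ContinuousSMul ℂ A] {F : (n : ℕ) → (Fin (n + 1) → ℂ) → ℂ}
    (T : (n : ℕ) → Set (Fin (n + 1) → ℂ))
    (hT : ∀ n, ∀ w ∈ T (n + 1), (fun i : Fin (n + 1) => w i.castSucc) ∈ T n) :
    ∀ m, (∀ j ≤ m, ContinuousOn (F j) (T j)) →
    ContinuousOn (fun q : A × (Fin (m + 1) → ℂ) => aeval q.1 (newton F m q.2))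
      (univ ×ˢ T m) := by
  intro m
  induction m with
  | zero =>
    intro hF
    simp only [newton, aeval_C, Algebra.algebraMap_eq_smul_one]
    exact ((hF 0 le_rfl).comp continuousOn_snd fun q hq => hq.2).smul continuousOn_const
  | succ m ih =>
    intro hF
    simp only [newton, map_add, map_mul, aeval_C, Algebra.algebraMap_eq_smul_one, smul_mul_assoc,
      one_mul]
    have hc : Continuous fun q : A × (Fin (m + 1 + 1) → ℂ) =>
        ((q.1, fun i : Fin (m + 1) => q.2 i.castSucc) : A × (Fin (m + 1) → ℂ)) := by fun_prop
    refine ContinuousOn.add ?_ (ContinuousOn.smul ?_ ?_)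
    · exact (ih fun j hj => hF j (hj.trans (Nat.le_succ m))).comp hc.continuousOn
        fun q hq => ⟨mem_univ _, hT m _ hq.2⟩
    · exact (hF (m + 1) le_rfl).comp continuousOn_snd fun q hq => hq.2
    · exact ((continuous_aeval_prod_X_sub_C (m + 1)).comp hc).continuousOn

/-! ### Limits of divided differences -/

/-- The `m`-tuples of points of `S` all of whose repeated entries are cluster points of `S`. -/
def repTuples (m : ℕ) (S : Set ℂ) : Set (Fin m → ℂ) :=
  {w | (∀ i, w i ∈ S) ∧ ∀ i j, i ≠ j → w i = w j → w i ∈ clusterPts S}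

theorem distinctTuples_subset_repTuples (m : ℕ) (S : Set ℂ) :
    distinctTuples m S ⊆ repTuples m S :=
  fun _ hw => ⟨hw.1, fun _ _ hij h => absurd (hw.2 h) hij⟩

theorem repTuples_comp {m l : ℕ} {S : Set ℂ} {w : Fin m → ℂ} (hw : w ∈ repTuples m S)
    {e : Fin l → Fin m} (he : Function.Injective e) : (fun i => w (e i)) ∈ repTuples l S :=
  ⟨fun _ => hw.1 _, fun _ _ hij h => hw.2 _ _ (he.ne hij) h⟩

theorem distinctTuples_comp {m l : ℕ} {S : Set ℂ} {w : Fin m → ℂ} (hw : w ∈ distinctTuples m S)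
    {e : Fin l → Fin m} (he : Function.Injective e) : (fun i => w (e i)) ∈ distinctTuples l S :=
  ⟨fun _ => hw.1 _, hw.2.comp he⟩

theorem const_mem_repTuples {m : ℕ} {S : Set ℂ} {a : ℂ} (ha : a ∈ clusterPts S) :
    (fun _ => a) ∈ repTuples m S :=
  ⟨fun _ => ha.1, fun _ _ _ _ => ha⟩

theorem infinite_inter_of_mem_clusterPts {S : Set ℂ} {a : ℂ} (ha : a ∈ clusterPts S) {U : Set ℂ}
    (hU : U ∈ 𝓝 a) : (U ∩ S).Infinite := by
  have h : AccPt a (𝓟 S) :=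
    accPt_principal_iff_nhdsWithin.2 (mem_closure_iff_nhdsWithin_neBot.1 ha.2)
  exact Set.Infinite.of_accPt (h.nhds_inter hU)

/-- Entries are perturbed one at a time. An isolated value occurs only once and stays; near a
cluster point infinitely many points of `S` are available, so the finitely many forbidden ones can
be avoided. -/
theorem repTuples_subset_closure (m : ℕ) (S : Set ℂ) :
    repTuples m S ⊆ closure (distinctTuples m S) := by
  classical
  intro w hw
  rw [Metric.mem_closure_iff]
  intro ε hε
  -- Moved entries avoid `range w`, so that an isolated value treated later cannot collide with an
  -- entry moved earlier.
  have key : ∀ s : Finset (Fin m), ∃ v : Fin m → ℂ, ∀ i ∈ s, v i ∈ S ∧ dist (w i) (v i) < ε ∧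
      (v i = w i ∨ (w i ∈ clusterPts S ∧ v i ∉ range w)) ∧ ∀ j ∈ s, v i = v j → i = j := by
    intro s
    induction s using Finset.induction with
    | empty => exact ⟨w, by simp⟩
    | insert i s hi ih =>
      obtain ⟨v, hv⟩ := ih
      have upd : ∀ x : ℂ, x ∈ S → dist (w i) x < ε →
          (x = w i ∨ (w i ∈ clusterPts S ∧ x ∉ range w)) → (∀ j ∈ s, v j ≠ x) →
          ∃ v : Fin m → ℂ, ∀ p ∈ insert i s, v p ∈ S ∧ dist (w p) (v p) < ε ∧
            (v p = w p ∨ (w p ∈ clusterPts S ∧ v p ∉ range w)) ∧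
            ∀ j ∈ insert i s, v p = v j → p = j := by
        intro x hx hd ho hne
        have hs : ∀ j ∈ s, Function.update v i x j = v j := fun j hj =>
          Function.update_of_ne (by rintro rfl; exact hi hj) _ _
        refine ⟨Function.update v i x, fun p hp => ?_⟩
        by_cases hpi : p = i
        · subst hpi
          simp only [Function.update_self]
          refine ⟨hx, hd, ho, fun j hj h => ?_⟩
          rcases Finset.mem_insert.1 hj with rfl | hj
          · rfl
          · rw [hs j hj] at h
            exact absurd h.symm (hne j hj)
        · replace hp : p ∈ s := (Finset.mem_insert.1 hp).resolve_left hpi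
          rw [hs p hp]
          refine ⟨(hv p hp).1, (hv p hp).2.1, (hv p hp).2.2.1, fun j hj h => ?_⟩
          by_cases hji : j = i
          · subst hji
            rw [Function.update_self] at h
            exact absurd h (hne p (by assumption))
          · replace hj : j ∈ s := (Finset.mem_insert.1 hj).resolve_left hji
            rw [hs j hj] at h
            exact (hv p hp).2.2.2 j hj h
      by_cases hc : w i ∈ clusterPts S
      · have hinf := infinite_inter_of_mem_clusterPts hc (Metric.ball_mem_nhds _ hε)
        obtain ⟨x, ⟨hxb, hxS⟩, hx⟩ :=
          (hinf.sdiff ((Set.finite_range w).union (Set.finite_range v))).nonempty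
        rw [mem_union, not_or] at hx
        exact upd x hxS (by rwa [dist_comm]) (Or.inr ⟨hc, hx.1⟩) fun j _ h => hx.2 ⟨j, h⟩
      · refine upd (w i) (hw.1 i) (by simpa using hε) (Or.inl rfl) fun j hj h => ?_
        rcases (hv j hj).2.2.1 with h1 | h1
        · exact hc (hw.2 i j (fun h => hi (h ▸ hj)) (h.symm.trans h1))
        · exact h1.2 ⟨i, h.symm⟩
  obtain ⟨v, hv⟩ := key Finset.univ
  refine ⟨v, ⟨fun i => (hv i (Finset.mem_univ i)).1, fun i j h =>
    (hv i (Finset.mem_univ i)).2.2.2 j (Finset.mem_univ j) h⟩, ?_⟩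
  rw [dist_pi_lt_iff hε]
  exact fun i => (hv i (Finset.mem_univ i)).2.1

/-- With the density result this makes `repTuples` the trace on tuples from `S` of a closed set,
which later yields compactness. Two nearby distinct values cannot both equal the repeated one. -/
theorem mem_repTuples_of_mem_closure {m : ℕ} {S : Set ℂ} {w : Fin m → ℂ} (hwS : ∀ i, w i ∈ S)
    (hw : w ∈ closure (distinctTuples m S)) : w ∈ repTuples m S := by
  refine ⟨hwS, fun i j hij h => ⟨hwS i, ?_⟩⟩
  rw [Metric.mem_closure_iff] at hw ⊢
  intro ε hε
  obtain ⟨v, hv, hd⟩ := hw ε hε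
  rw [dist_pi_lt_iff hε] at hd
  by_cases hi : v i = w i
  · refine ⟨v j, ⟨hv.1 j, fun hj => hij (hv.2 (hi.trans ?_))⟩, h ▸ hd j⟩
    exact (mem_singleton_iff.1 hj).symm
  · exact ⟨v i, ⟨hv.1 i, hi⟩, hd i⟩

/-- Consecutive windows of length `n + 1` have divided differences whose gap is a bounded divided
difference of order `n + 1` times a distance of size `O(ρ)`. Hence the order `n` values form a
Cauchy filter. -/
theorem IsDDC.of_succ {n : ℕ} {S : Set ℂ} {f : ℂ → ℂ} (h : IsDDC (n + 1) S f) : IsDDC n S f := by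
  intro a ha
  obtain ⟨L, hL⟩ := h a ha
  obtain ⟨r, hr, C, hC0, hC⟩ : ∃ r > 0, ∃ C > 0, ∀ z ∈ distinctTuples (n + 2) S,
      (∀ i, dist (z i) a < r) → ‖divDiff f (n + 1) z‖ ≤ C := by
    have h1 : ∀ᶠ z in 𝓝[distinctTuples (n + 1 + 1) S] (fun _ => a),
        ‖divDiff f (n + 1) z‖ < ‖L‖ + 1 :=
      hL.norm.eventually (gt_mem_nhds (lt_add_one _))
    rw [Filter.Eventually, Metric.mem_nhdsWithin_iff] at h1
    obtain ⟨r, hr, hsub⟩ := h1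
    refine ⟨r, hr, ‖L‖ + 1, by positivity, fun z hz hd => (hsub ⟨?_, hz⟩).le⟩
    rw [Metric.mem_ball, dist_pi_lt_iff hr]
    exact hd
  -- two disjoint tuples are joined by sliding a window along their concatenation
  have slide : ∀ ρ ≤ r, ∀ c : ℕ → ℂ, Set.InjOn c (Set.Iio (2 * n + 2)) →
      (∀ i < 2 * n + 2, c i ∈ S ∧ dist (c i) a < ρ) → ∀ p ≤ n + 1,
      ‖divDiff f n (fun i => c (i + p)) - divDiff f n (fun i => c i)‖ ≤ p * (C * (2 * ρ)) := by
    intro ρ hρ c hinj hc p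
    induction p with
    | zero => simp
    | succ p ih =>
      intro hp
      have ih := ih (by omega)
      have hmem : (fun i : Fin (n + 2) => c (i + p)) ∈ distinctTuples (n + 2) S := by
        refine ⟨fun i => (hc _ (by omega)).1, fun i j hij => ?_⟩
        have := hinj (show (i : ℕ) + p < 2 * n + 2 by omega) (show (j : ℕ) + p < _ by omega) hij
        ext; omega
      have hb := hC _ hmem fun i => (hc _ (by omega)).2.trans_le hρ
      have hne : c (n + 1 + p) - c (0 + p) ≠ 0 := sub_ne_zero.2 fun h => by
        have := hinj (show n + 1 + p < 2 * n + 2 by omega) (show 0 + p < _ by omega) h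
        omega
      have heq : divDiff f n (fun i => c (i + (p + 1))) - divDiff f n (fun i => c (i + p)) =
          divDiff f (n + 1) (fun i : Fin (n + 2) => c (i + p)) * (c (n + 1 + p) - c (0 + p)) := by
        rw [divDiff]
        simp only [Fin.val_succ, Fin.val_castSucc, Fin.val_last, Fin.val_zero]
        rw [div_mul_cancel₀ _ hne]
        simp only [add_assoc, add_comm 1 p]
      have hlen : ‖c (n + 1 + p) - c (0 + p)‖ ≤ 2 * ρ := by
        rw [← dist_eq_norm]
        refine (dist_triangle_right _ _ a).trans ?_
        have h1 := (hc (n + 1 + p) (by omega)).2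
        have h2 := (hc (0 + p) (by omega)).2
        linarith
      calc ‖divDiff f n (fun i => c (i + ↑(p + 1))) - divDiff f n (fun i => c i)‖
          = ‖(divDiff f n (fun i => c (i + (p + 1))) - divDiff f n (fun i => c (i + p))) +
              (divDiff f n (fun i => c (i + p)) - divDiff f n (fun i => c i))‖ := by
            congr 1; ring
        _ ≤ C * (2 * ρ) + p * (C * (2 * ρ)) := by
            refine (norm_add_le _ _).trans (add_le_add ?_ ih)
            rw [heq, norm_mul]
            exact mul_le_mul hb hlen (norm_nonneg _) hC0.le
        _ = _ := by push_cast; ring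
  have near : ∀ ρ ≤ r, ∀ z ∈ distinctTuples (n + 1) S, ∀ w ∈ distinctTuples (n + 1) S,
      (∀ i, dist (z i) a < ρ) → (∀ i, dist (w i) a < ρ) → (∀ i j, z i ≠ w j) →
      ‖divDiff f n w - divDiff f n z‖ ≤ (n + 1 : ℕ) * (C * (2 * ρ)) := by
    intro ρ hρ z hz w hw hzd hwd hne
    set c : ℕ → ℂ := fun i => if h : i < n + 1 then z ⟨i, h⟩ else
      if h' : i - (n + 1) < n + 1 then w ⟨i - (n + 1), h'⟩ else 0 with hcdef
    have hc1 : ∀ i (h : i < n + 1), c i = z ⟨i, h⟩ := fun i h => dif_pos h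
    have hc2 : ∀ i (h : i < n + 1), c (i + (n + 1)) = w ⟨i, h⟩ := fun i h => by
      have h1 : ¬ (i + (n + 1) < n + 1) := by omega
      simp only [hcdef, dif_neg h1, Nat.add_sub_cancel, dif_pos h]
    have hcase : ∀ i < 2 * n + 2, (∃ h : i < n + 1, c i = z ⟨i, h⟩) ∨
        ∃ j, ∃ h : j < n + 1, i = j + (n + 1) ∧ c i = w ⟨j, h⟩ := by
      intro i hi
      rcases lt_or_ge i (n + 1) with h | h
      · exact Or.inl ⟨h, hc1 i h⟩
      · obtain ⟨j, rfl⟩ := Nat.exists_eq_add_of_le' h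
        exact Or.inr ⟨j, by omega, rfl, hc2 j (by omega)⟩
    have := slide ρ hρ c ?_ ?_ (n + 1) le_rfl
    · have e1 : (fun i : Fin (n + 1) => c (i + (n + 1))) = w := by
        ext i; exact hc2 i i.2
      have e2 : (fun i : Fin (n + 1) => c i) = z := by
        ext i; exact hc1 i i.2
      rwa [e1, e2] at this
    · intro i hi j hj hij
      rcases hcase i hi with ⟨h1, e1⟩ | ⟨i', h1, rfl, e1⟩ <;>
      rcases hcase j hj with ⟨h2, e2⟩ | ⟨j', h2, rfl, e2⟩ <;> rw [e1, e2] at hij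
      · simpa using hz.2 hij
      · exact absurd hij (hne _ _)
      · exact absurd hij.symm (hne _ _)
      · have := hw.2 hij
        simp only [Fin.mk.injEq] at this
        omega
    · intro i hi
      rcases hcase i hi with ⟨h1, e1⟩ | ⟨i', h1, -, e1⟩ <;> rw [e1]
      exacts [⟨hz.1 _, hzd _⟩, ⟨hw.1 _, hwd _⟩]
  -- The tuples `z` and `w` may share points, so both are compared with a third tuple disjoint from
  -- each of them.
  have cauchy : ∀ ρ > 0, ρ ≤ r → ∀ z ∈ distinctTuples (n + 1) S, ∀ w ∈ distinctTuples (n + 1) S,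
      (∀ i, dist (z i) a < ρ) → (∀ i, dist (w i) a < ρ) →
      dist (divDiff f n z) (divDiff f n w) ≤ 2 * ((n + 1 : ℕ) * (C * (2 * ρ))) := by
    intro ρ hρ0 hρ z hz w hw hzd hwd
    have hinf := infinite_inter_of_mem_clusterPts ha (Metric.ball_mem_nhds a hρ0)
    have hinf' := hinf.sdiff ((Set.finite_range z).union (Set.finite_range w))
    set u : Fin (n + 1) → ℂ := fun i => (hinf'.natEmbedding _ i : ℂ)
    have hu : ∀ i, u i ∈ (Metric.ball a ρ ∩ S) \ (range z ∪ range w) := fun i =>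
      (hinf'.natEmbedding _ i).2
    have hud : u ∈ distinctTuples (n + 1) S := by
      refine ⟨fun i => (hu i).1.2, fun i j hij => ?_⟩
      have := (hinf'.natEmbedding _).injective (Subtype.ext hij)
      exact Fin.ext this
    have h1 := near ρ hρ z hz u hud hzd (fun i => (hu i).1.1)
      fun i j h => (hu j).2 (Or.inl ⟨i, h⟩)
    have h2 := near ρ hρ w hw u hud hwd (fun i => (hu i).1.1)
      fun i j h => (hu j).2 (Or.inr ⟨i, h⟩)
    refine (dist_triangle_left _ _ (divDiff f n u)).trans ?_
    rw [dist_eq_norm, dist_eq_norm]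
    linarith
  have hne : NeBot (𝓝[distinctTuples (n + 1) S] (fun _ => a)) :=
    mem_closure_iff_nhdsWithin_neBot.1 (repTuples_subset_closure _ _ (const_mem_repTuples ha))
  refine CompleteSpace.complete (Metric.cauchy_iff.2 ⟨hne.map _, fun ε hε => ?_⟩)
  -- Chosen so that the Cauchy bound `4 (n + 1) C ρ` is less than `ε`.
  set ρ : ℝ := min r (ε / (4 * ((n + 1 : ℕ) * C) + 1) / 2) with hρ
  have hρ0 : 0 < ρ := lt_min hr (by positivity)
  refine ⟨divDiff f n '' (Metric.ball (fun _ => a) ρ ∩ distinctTuples (n + 1) S),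
    image_mem_map (inter_mem (mem_nhdsWithin_of_mem_nhds (Metric.ball_mem_nhds _ hρ0))
      self_mem_nhdsWithin), ?_⟩
  rintro _ ⟨z, ⟨hz, hzd⟩, rfl⟩ _ ⟨w, ⟨hw, hwd⟩, rfl⟩
  rw [Metric.mem_ball, dist_pi_lt_iff hρ0] at hz hw
  refine (cauchy ρ hρ0 (min_le_left _ _) z hzd w hwd hz hw).trans_lt ?_
  have h1 : ρ ≤ ε / (4 * ((n + 1 : ℕ) * C) + 1) / 2 := min_le_right _ _
  have hpos : (0 : ℝ) < 4 * ((n + 1 : ℕ) * C) + 1 := by positivity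
  rw [div_div, le_div_iff₀ (by positivity)] at h1
  nlinarith

theorem IsDDC.of_le {n j : ℕ} {S : Set ℂ} {f : ℂ → ℂ} (h : IsDDC n S f) (hj : j ≤ n) :
    IsDDC j S f := by
  induction hj using Nat.decreasingInduction with
  | self => exact h
  | of_succ m _ ih => exact ih.of_succ

/-- The hypothesis concerns constant tuples only. At any other tuple, symmetry moves an entry
different from `w 0` to the last slot; the recursion is then a quotient whose denominator has a
nonzero limit, and lower orders apply. -/
theorem exists_tendsto_divDiff {S : Set ℂ} {f : ℂ → ℂ} : ∀ {m : ℕ}, IsDDC m S f →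
    ∀ w ∈ repTuples (m + 1) S,
      ∃ y, Tendsto (divDiff f m) (𝓝[distinctTuples (m + 1) S] w) (𝓝 y) := by
  intro m
  induction m with
  | zero =>
    intro h w hw
    by_cases hc : w 0 ∈ clusterPts S
    · obtain ⟨L, hL⟩ := h _ hc
      have e : w = fun _ => w 0 := funext fun i => by rw [Fin.fin_one_eq_zero i]
      rw [e]
      exact ⟨L, hL⟩
    · refine ⟨f (w 0), tendsto_const_nhds.congr' ?_⟩
      have h1 : w 0 ∉ closure (S \ {w 0}) := fun h1 => hc (show _ ∧ _ from ⟨hw.1 0, h1⟩)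
      have h2 : ∀ᶠ z in 𝓝 (w 0), z ∉ closure (S \ {w 0}) :=
        isClosed_closure.isOpen_compl.mem_nhds h1
      have h3 : ∀ᶠ z : Fin 1 → ℂ in 𝓝 w, z 0 ∉ closure (S \ {w 0}) :=
        (continuous_apply (0 : Fin 1)).continuousAt.eventually h2
      filter_upwards [mem_nhdsWithin_of_mem_nhds h3, self_mem_nhdsWithin] with z hz hzd
      by_cases hzw : z 0 = w 0
      · simp [divDiff, hzw]
      · exact absurd (subset_closure (mem_sdiff_of_mem (hzd.1 0) hzw)) hz
  | succ m ih =>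
    intro h w hw
    by_cases hall : ∀ i, w i = w 0
    · have hc : w 0 ∈ clusterPts S := hw.2 0 (Fin.last _) (by simp [Fin.ext_iff]) (hall _).symm
      obtain ⟨L, hL⟩ := h _ hc
      rw [show w = fun _ => w 0 from funext hall]
      exact ⟨L, hL⟩
    · push Not at hall
      obtain ⟨p, hp⟩ := hall
      set σ : Equiv.Perm (Fin (m + 1 + 1)) := Equiv.swap p (Fin.last _) with hσ
      have hp0 : p ≠ 0 := fun h => hp (by rw [h])
      have hσ0 : σ 0 = 0 := Equiv.swap_apply_of_ne_of_ne hp0.symm (by simp [Fin.ext_iff])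
      have hσl : σ (Fin.last _) = p := Equiv.swap_apply_right _ _
      have hcomp : ∀ {l : ℕ} (e : Fin l → Fin (m + 1 + 1)), Function.Injective e →
          Tendsto (fun z : Fin (m + 1 + 1) → ℂ => fun i => z (e i))
            (𝓝[distinctTuples (m + 1 + 1) S] w) (𝓝[distinctTuples l S] fun i => w (e i)) :=
        fun e he => tendsto_nhdsWithin_iff.2 ⟨(Continuous.tendsto (by fun_prop) w).mono_left
          nhdsWithin_le_nhds, eventually_nhdsWithin_of_forall fun z hz => distinctTuples_comp hz he⟩
      have h1 : Function.Injective fun i : Fin (m + 1) => σ i.succ :=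
        σ.injective.comp (Fin.succ_injective _)
      have h2 : Function.Injective fun i : Fin (m + 1) => σ i.castSucc :=
        σ.injective.comp (Fin.castSucc_injective _)
      obtain ⟨y1, hy1⟩ := ih h.of_succ _ (repTuples_comp hw h1)
      obtain ⟨y2, hy2⟩ := ih h.of_succ _ (repTuples_comp hw h2)
      have hd : Tendsto (fun z : Fin (m + 1 + 1) → ℂ => z p - z 0)
          (𝓝[distinctTuples (m + 1 + 1) S] w) (𝓝 (w p - w 0)) :=
        (Continuous.tendsto (by fun_prop) w).mono_left nhdsWithin_le_nhds
      refine ⟨_, (((hy1.comp (hcomp _ h1)).sub (hy2.comp (hcomp _ h2))).div hd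
        (sub_ne_zero.2 hp)).congr' ?_⟩
      filter_upwards [self_mem_nhdsWithin] with z hz
      rw [← divDiff_comp_perm f hz.2 σ, divDiff]
      simp [hσ0, hσl]

/-- The continuous extension of the divided differences to tuples with repeated entries. -/
def divDiffExt (S : Set ℂ) (f : ℂ → ℂ) (m : ℕ) (w : Fin (m + 1) → ℂ) : ℂ :=
  extendFrom (distinctTuples (m + 1) S) (divDiff f m) w

theorem continuousOn_divDiffExt {S : Set ℂ} {f : ℂ → ℂ} {m : ℕ} (h : IsDDC m S f) :
    ContinuousOn (divDiffExt S f m) (repTuples (m + 1) S) :=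
  continuousOn_extendFrom (repTuples_subset_closure _ _) (exists_tendsto_divDiff h)

theorem divDiffExt_eq {S : Set ℂ} {f : ℂ → ℂ} {m : ℕ} (h : IsDDC m S f) {w : Fin (m + 1) → ℂ}
    (hw : w ∈ distinctTuples (m + 1) S) : divDiffExt S f m w = divDiff f m w := by
  obtain ⟨y, hy⟩ := exists_tendsto_divDiff h w (distinctTuples_subset_repTuples _ _ hw)
  refine extendFrom_eq (subset_closure hw) ?_
  have := tendsto_nhds_unique (hy.mono_left (pure_le_nhdsWithin hw))
    (tendsto_pure_nhds (divDiff f m) w)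
  rwa [← this]

theorem IsDDC.continuousOn {n : ℕ} {S : Set ℂ} {f : ℂ → ℂ} (h : IsDDC n S f) :
    ContinuousOn f S := by
  have h0 := h.of_le (Nat.zero_le n)
  have hmem : ∀ z ∈ S, (fun _ => z) ∈ distinctTuples 1 S := fun z hz =>
    ⟨fun _ => hz, Function.injective_of_subsingleton _⟩
  have h1 : ContinuousOn (fun z : ℂ => divDiffExt S f 0 fun _ => z) S :=
    (continuousOn_divDiffExt h0).comp (Continuous.continuousOn (by fun_prop))
      fun z hz => distinctTuples_subset_repTuples _ _ (hmem z hz)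
  exact h1.congr fun z hz => (divDiffExt_eq h0 (hmem z hz)).symm

theorem divDiff_congr {f g : ℂ → ℂ} : ∀ {m : ℕ} {w : Fin (m + 1) → ℂ},
    (∀ i, g (w i) = f (w i)) → divDiff g m w = divDiff f m w := by
  intro m
  induction m with
  | zero => exact fun h => h 0
  | succ m ih =>
    intro w h
    rw [divDiff, divDiff, ih fun i => h _, ih fun i => h _]

theorem continuousOn_divDiff {S : Set ℂ} {f : ℂ → ℂ} (hf : ContinuousOn f S) :
    ∀ m, ContinuousOn (divDiff f m) (distinctTuples (m + 1) S) := by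
  intro m
  induction m with
  | zero => exact hf.comp (continuous_apply _).continuousOn fun z hz => hz.1 0
  | succ m ih =>
    simp only [funext fun w => divDiff.eq_2 f m w]
    refine ((ih.comp (Continuous.continuousOn (by fun_prop)) fun z hz =>
      distinctTuples_comp hz (Fin.succ_injective _)).sub
      (ih.comp (Continuous.continuousOn (by fun_prop)) fun z hz =>
      distinctTuples_comp hz (Fin.castSucc_injective _))).div
      (Continuous.continuousOn (by fun_prop)) fun z hz => sub_ne_zero.2 fun h => ?_
    simpa [Fin.ext_iff] using hz.2 h

/-! ### Hermite interpolation with repeated nodes -/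

section Newton

variable {n : ℕ} {S : Set ℂ} {f : ℂ → ℂ}

theorem continuousOn_aeval_newton_divDiffExt {A : Type*} [Ring A] [Algebra ℂ A]
    [TopologicalSpace A] [IsTopologicalRing A] [ContinuousSMul ℂ A] (h : IsDDC n S f) {m : ℕ}
    (hm : m ≤ n) :
    ContinuousOn (fun q : A × (Fin (m + 1) → ℂ) => aeval q.1 (newton (divDiffExt S f) m q.2))
      (univ ×ˢ repTuples (m + 1) S) :=
  continuousOn_aeval_newton (fun n => repTuples (n + 1) S)
    (fun _ _ hw => repTuples_comp hw (Fin.castSucc_injective _)) m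
    fun _ hj => continuousOn_divDiffExt (h.of_le (hj.trans hm))

theorem newton_divDiffExt_of_distinct (h : IsDDC n S f) : ∀ {m : ℕ}, m ≤ n →
    ∀ {w : Fin (m + 1) → ℂ}, w ∈ distinctTuples (m + 1) S →
      newton (divDiffExt S f) m w = newton (divDiff f) m w := by
  intro m
  induction m with
  | zero => intro hm w hw; rw [newton, newton, divDiffExt_eq (h.of_le hm) hw]
  | succ m ih =>
    intro hm w hw
    rw [newton, newton, divDiffExt_eq (h.of_le hm) hw,
      ih (by omega) (distinctTuples_comp hw (Fin.castSucc_injective _))]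

theorem continuousOn_eval_newton (h : IsDDC n S f) {m : ℕ} (hm : m ≤ n)
    {g : (Fin (m + 1) → ℂ) → ℂ} (hg : Continuous g) :
    ContinuousOn (fun w => (newton (divDiffExt S f) m w).eval (g w)) (repTuples (m + 1) S) := by
  have := (continuousOn_aeval_newton_divDiffExt (A := ℂ) h hm).comp
    (hg.prodMk continuous_id).continuousOn fun w (hw : w ∈ repTuples (m + 1) S) => ⟨mem_univ _, hw⟩
  simpa only [Function.comp_def, coe_aeval_eq_eval, id_eq] using this

/-- Known for distinct nodes; both sides are continuous in `w`, and distinct tuples are dense in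
`repTuples`. -/
theorem eval_newton_node (h : IsDDC n S f) {m : ℕ} (hm : m ≤ n) {w : Fin (m + 1) → ℂ}
    (hw : w ∈ repTuples (m + 1) S) (i : Fin (m + 1)) :
    (newton (divDiffExt S f) m w).eval (w i) = f (w i) := by
  have h1 : EqOn (fun w : Fin (m + 1) → ℂ => (newton (divDiffExt S f) m w).eval (w i))
      (fun w => f (w i)) (distinctTuples (m + 1) S) := fun w hw => by
    simp only [newton_divDiffExt_of_distinct h hm hw]
    exact eval_newton_node_of_injective f m w hw.2 i
  exact h1.of_subset_closure (continuousOn_eval_newton h hm (continuous_apply i))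
    (h.continuousOn.comp (continuous_apply i).continuousOn fun w hw => hw.1 i)
    (distinctTuples_subset_repTuples _ _) (repTuples_subset_closure _ _) hw

theorem newton_comp_perm (h : IsDDC n S f) {m : ℕ} (hm : m ≤ n) {w : Fin (m + 1) → ℂ}
    (hw : w ∈ repTuples (m + 1) S) (σ : Equiv.Perm (Fin (m + 1))) :
    newton (divDiffExt S f) m (w ∘ σ) = newton (divDiffExt S f) m w := by
  refine Polynomial.funext fun x => ?_
  have h1 : EqOn (fun w : Fin (m + 1) → ℂ => (newton (divDiffExt S f) m (w ∘ σ)).eval x)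
      (fun w => (newton (divDiffExt S f) m w).eval x) (distinctTuples (m + 1) S) := fun w hw => by
    simp only [newton_divDiffExt_of_distinct h hm hw]
    rw [newton_divDiffExt_of_distinct h hm (w := w ∘ σ) (distinctTuples_comp hw σ.injective),
      newton_comp_perm_of_injective f hw.2]
  have h2 := continuousOn_eval_newton h hm (g := fun _ => x) continuous_const
  exact h1.of_subset_closure (h2.comp (f := fun w : Fin (m + 1) → ℂ => w ∘ σ)
    (Continuous.continuousOn (by fun_prop)) fun w hw => repTuples_comp hw σ.injective) h2
    (distinctTuples_subset_repTuples _ _) (repTuples_subset_closure _ _) hw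

/-- The Taylor polynomial of order `n` at `a` built from confluent divided differences. -/
def confluentTaylor (S : Set ℂ) (f : ℂ → ℂ) (n : ℕ) (a : ℂ) : ℂ[X] :=
  ∑ j ∈ Finset.range (n + 1), C (divDiffExt S f j fun _ => a) * (X - C a) ^ j

theorem newton_const (a : ℂ) : ∀ m : ℕ,
    newton (divDiffExt S f) m (fun _ => a) = confluentTaylor S f m a := by
  intro m
  induction m with
  | zero => simp [newton, confluentTaylor]
  | succ m ih =>
    rw [newton, ih, confluentTaylor, confluentTaylor, Finset.sum_range_succ _ (m + 1)]
    simp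

theorem eval_iterate_derivative_confluentTaylor (a : ℂ) {s : ℕ} (hs : s ≤ n) :
    (derivative^[s] (confluentTaylor S f n a)).eval a =
      s.factorial * divDiffExt S f s fun _ => a := by
  have h1 : (taylor a (confluentTaylor S f n a)).coeff s = divDiffExt S f s fun _ => a := by
    simp only [confluentTaylor, map_sum, taylor_mul, taylor_C, taylor_pow, map_sub, taylor_X,
      add_sub_cancel_right, finsetSum_coeff, coeff_C_mul, coeff_X_pow]
    rw [Finset.sum_eq_single s]
    · simp
    · intro j _ hj
      simp [hj.symm]
    · intro h
      exact absurd (Finset.mem_range.2 (Nat.lt_succ_of_le hs)) h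
  rw [taylor_coeff] at h1
  rw [← factorial_smul_hasseDeriv, LinearMap.smul_apply, eval_smul, h1, nsmul_eq_mul]

theorem pow_dvd_confluentTaylor_sub (a : ℂ) {m : ℕ} (hm : m ≤ n) :
    (X - C a) ^ (m + 1) ∣ confluentTaylor S f m a - confluentTaylor S f n a := by
  induction n, hm using Nat.le_induction with
  | base => simp
  | succ n hm ih =>
    rw [confluentTaylor, confluentTaylor, Finset.sum_range_succ _ (n + 1), ← sub_sub]
    exact dvd_sub ih (dvd_mul_of_dvd_right (pow_dvd_pow _ (by omega)) _)

theorem pow_dvd_prod_X_sub_C {ι : Type*} [Fintype ι] (w : ι → ℂ) (a : ℂ) (p : ι → Prop)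
    [DecidablePred p] (hw : ∀ i, p i → w i = a) :
    (X - C a) ^ (Finset.univ.filter p).card ∣ ∏ i, (X - C (w i)) := by
  refine dvd_trans (dvd_of_eq ?_)
    (Finset.prod_dvd_prod_of_subset _ _ (fun i => X - C (w i))
      (Finset.subset_univ (Finset.univ.filter p)))
  rw [← Finset.prod_const]
  refine Finset.prod_congr rfl fun i hi => ?_
  rw [hw i (Finset.mem_filter.1 hi).2]

/-- When the first `c` nodes equal `a`, the first `c` Newton terms are those of the Taylor
polynomial, and every later term of either contains `(X - C a) ^ c`. -/
theorem pow_dvd_newton_sub_confluentTaylor (a : ℂ) (c : ℕ) : ∀ {m : ℕ}, m ≤ n → c ≤ m + 1 →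
    ∀ w : Fin (m + 1) → ℂ, (∀ i : Fin (m + 1), (i : ℕ) < c → w i = a) →
      (X - C a) ^ c ∣ newton (divDiffExt S f) m w - confluentTaylor S f n a := by
  intro m
  induction m with
  | zero =>
    intro hm hc w hw
    rcases Nat.le_one_iff_eq_zero_or_eq_one.1 hc with rfl | rfl
    · simp
    · obtain rfl : w = fun _ => a := funext fun i => hw i i.2
      rw [newton_const]
      exact pow_dvd_confluentTaylor_sub a hm
  | succ m ih =>
    intro hm hc w hw
    rcases hc.eq_or_lt with rfl | hc
    · obtain rfl : w = fun _ => a := funext fun i => hw i i.2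
      rw [newton_const]
      exact pow_dvd_confluentTaylor_sub a hm
    · rw [newton, add_sub_right_comm]
      refine dvd_add (ih (by omega) (by omega) _ fun i hi => hw _ hi) (dvd_mul_of_dvd_right ?_ _)
      have := pow_dvd_prod_X_sub_C (fun i : Fin (m + 1) => w i.castSucc) a (fun i => (i : ℕ) < c)
        fun i hi => hw _ hi
      rwa [Fin.card_filter_val_lt, min_eq_right (by omega)] at this

theorem snoc_const_mem_repTuples {a : ℂ} (ha : a ∈ clusterPts S) {z : ℂ} (hz : z ∈ S) (m : ℕ) :
    (Fin.snoc (α := fun _ => ℂ) (fun _ : Fin m => a) z : Fin (m + 1) → ℂ) ∈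
      repTuples (m + 1) S := by
  refine ⟨fun i => ?_, fun i j hij h => ?_⟩
  · induction i using Fin.lastCases with
    | last => simpa using hz
    | cast i => simpa using ha.1
  · induction i using Fin.lastCases with
    | last =>
      induction j using Fin.lastCases with
      | last => exact absurd rfl hij
      | cast j =>
        rw [h]
        simpa using ha
    | cast i => simpa using ha

/-- A function of class `DDC^n` has the Taylor expansion given by confluent divided differences. -/
theorem IsDDC.isTaylorAt (hn : 1 ≤ n) (h : IsDDC n S f) {a : ℂ} (ha : a ∈ clusterPts S) :
    IsTaylorAt S f n a (fun j => j.factorial * divDiffExt S f j fun _ => a)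
      (fun z => divDiffExt S f n (Fin.snoc (α := fun _ => ℂ) (fun _ => a) z) -
        divDiffExt S f n fun _ => a) := by
  have hsnoc : (Fin.snoc (α := fun _ => ℂ) (fun _ : Fin n => a) a : Fin (n + 1) → ℂ) =
      fun _ => a := by
    ext i
    induction i using Fin.lastCases <;> simp
  refine ⟨fun z hz => ?_, ?_, ?_⟩
  · obtain ⟨m, rfl⟩ := Nat.exists_eq_add_of_le' hn
    -- The Taylor formula is Newton interpolation at the nodes `a, …, a, z`, evaluated at the last
    -- node.
    have h1 := eval_newton_node h le_rfl (snoc_const_mem_repTuples ha hz (m + 1)) (Fin.last _)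
    simp only [Fin.snoc_last] at h1
    rw [← h1, newton]
    simp only [Fin.snoc_castSucc]
    rw [newton_const, confluentTaylor, Finset.sum_range_succ _ (m + 1)]
    have h2 : ∀ j : ℕ, (j.factorial * divDiffExt S f j fun _ => a) / (j.factorial : ℂ) =
        divDiffExt S f j fun _ => a := fun j =>
      mul_div_cancel_left₀ _ (Nat.cast_ne_zero.2 j.factorial_ne_zero)
    simp only [h2, eval_add, eval_finsetSum, eval_mul, eval_C, eval_pow, eval_sub, eval_X,
      Finset.prod_const, Finset.card_univ, Fintype.card_fin]
    ring
  · simp only [hsnoc, sub_self]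
  · refine ContinuousWithinAt.sub ?_ continuousWithinAt_const
    have h1 : ContinuousOn (fun z => divDiffExt S f n
        (Fin.snoc (α := fun _ => ℂ) (fun _ : Fin n => a) z)) S :=
      (continuousOn_divDiffExt h).comp (Continuous.continuousOn (by fun_prop))
        fun z hz => snoc_const_mem_repTuples ha hz n
    exact h1 a ha.1

theorem IsDDC.tDeriv_eq (hn : 1 ≤ n) (h : IsDDC n S f) {a : ℂ} (ha : a ∈ clusterPts S) {j : ℕ}
    (hj : j ≤ n) : tDeriv S f j a = j.factorial * divDiffExt S f j fun _ => a :=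
  MatCalc.tDeriv_eq ha (h.isTaylorAt hn ha) j hj

/-- The remainder is an extended divided difference at `(a, …, a, z)` minus one at `(a, …, a)`,
hence jointly continuous. -/
theorem IsDDC.isTC (hn : 1 ≤ n) (h : IsDDC n S f) : IsTC n S f := by
  refine Or.inr ⟨hn, fun a z => divDiffExt S f n (Fin.snoc (α := fun _ => ℂ) (fun _ => a) z) -
        divDiffExt S f n fun _ => a, fun a ha => ?_, fun j _ hj => ?_, ?_⟩
  · obtain ⟨h1, h2, h3⟩ := h.isTaylorAt hn ha
    refine ⟨fun z hz => ?_, h2, h3⟩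
    rw [h1 z hz]
    congr 1
    refine Finset.sum_congr rfl fun j hj => ?_
    simp only [h.tDeriv_eq hn ha (Nat.lt_succ_iff.1 (Finset.mem_range.1 hj))]
  · refine ContinuousOn.congr (ContinuousOn.mul continuousOn_const ?_)
      fun a ha => h.tDeriv_eq hn ha hj
    exact (continuousOn_divDiffExt (h.of_le hj)).comp (Continuous.continuousOn (by fun_prop))
      fun a ha => const_mem_repTuples ha
  · refine ContinuousOn.sub ?_ ?_
    · exact (continuousOn_divDiffExt h).comp (Continuous.continuousOn (by fun_prop))
        fun q hq => snoc_const_mem_repTuples hq.1 hq.2 n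
    · exact (continuousOn_divDiffExt h).comp (Continuous.continuousOn (by fun_prop))
        fun q hq => const_mem_repTuples hq.1

/-- Newton polynomials with repeated nodes are Hermite interpolation polynomials. -/
theorem eval_iterate_derivative_newton (hn : 1 ≤ n) (h : IsDDC n S f) {m : ℕ} (hm : m ≤ n)
    {w : Fin (m + 1) → ℂ} (hw : w ∈ repTuples (m + 1) S) (a : ℂ) {s : ℕ}
    (hs : s < (Finset.univ.filter fun i => w i = a).card) :
    (derivative^[s] (newton (divDiffExt S f) m w)).eval a = tDeriv S f s a := by
  classical
  obtain ⟨i, hi⟩ := Finset.card_pos.1 (Nat.zero_lt_of_lt hs)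
  replace hi : w i = a := (Finset.mem_filter.1 hi).2
  -- The case `s = 0` stands apart because a simple node may be isolated; a multiple node is a
  -- cluster point.
  rcases Nat.eq_zero_or_pos s with rfl | hs0
  · simpa [tDeriv, hi] using eval_newton_node h hm hw i
  have ha : a ∈ clusterPts S := by
    obtain ⟨p, hp, q, hq, hpq⟩ := Finset.one_lt_card.1 (lt_of_le_of_lt hs0 hs)
    rw [Finset.mem_filter] at hp hq
    rw [← hp.2]
    exact hw.2 p q hpq (hp.2.trans hq.2.symm)
  set c := (Finset.univ.filter fun i => w i = a).card with hc
  have hcm : c ≤ m + 1 := by simpa using Finset.card_le_univ (Finset.univ.filter fun i => w i = a)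
  have hcard : Fintype.card {i : Fin (m + 1) // (i : ℕ) < c} =
      Fintype.card {i : Fin (m + 1) // w i = a} := by
    rw [Fintype.card_subtype, Fintype.card_subtype, Fin.card_filter_val_lt, min_eq_right hcm]
  -- A permutation bringing the `c` copies of `a` to the front.
  set σ := (Fintype.equivOfCardEq hcard).extendSubtype
  have hσ : ∀ i : Fin (m + 1), (i : ℕ) < c → w (σ i) = a := fun i hi =>
    (Fintype.equivOfCardEq hcard).extendSubtype_mem i hi
  have hdvd := pow_dvd_newton_sub_confluentTaylor (S := S) (f := f) a c hm hcm (w ∘ σ) hσ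
  rw [newton_comp_perm h hm hw] at hdvd
  rw [eval_iterate_derivative_of_dvd hs hdvd,
    eval_iterate_derivative_confluentTaylor a (by omega), h.tDeriv_eq hn ha (by omega)]

theorem rootMultiplicity_prod_X_sub_C {ι : Type*} [Fintype ι] (w : ι → ℂ) (a : ℂ) :
    (∏ i, (X - C (w i))).rootMultiplicity a = (Finset.univ.filter fun i => w i = a).card := by
  classical
  have : ∏ i, (X - C (w i)) = ((Finset.univ.val.map w).map fun x => X - C x).prod := by
    rw [Multiset.map_map]; rfl
  rw [← count_roots, this, roots_multiset_prod_X_sub_C, Multiset.count_map, Finset.card_def,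
    Finset.filter_val]
  simp only [eq_comm]

/-- The nodes need only annihilate `Y`, not list the roots of its minimal polynomial. This condition
on `(Y, w)` is closed and so survives limits. -/
theorem matFun_eq_aeval_newton (hn : 1 ≤ n) (h : IsDDC n S f) {m : ℕ} (hm : m ≤ n)
    {w : Fin (m + 1) → ℂ} (hw : w ∈ repTuples (m + 1) S) {k : ℕ} {Y : Mat k}
    (hY : aeval Y (∏ i, (X - C (w i))) = 0) :
    matFun S f Y = aeval Y (newton (divDiffExt S f) m w) := by
  refine matFun_eq_aeval fun a _ s hs => eval_iterate_derivative_newton hn h hm hw a ?_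
  rw [← rootMultiplicity_prod_X_sub_C]
  refine hs.trans_le (rootMultiplicity_le_rootMultiplicity_of_dvd ?_ (minpoly.dvd _ _ hY) a)
  exact (monic_prod_of_monic _ _ fun i _ => monic_X_sub_C _).ne_zero

end Newton

/-! ### Uniform continuity of the functional calculus -/

/-- On a compact set the projection is a closed map. This removes the choice of nodes: a function of
`Y` is continuous once it is continuous as a function of `(Y, w)`. -/
theorem continuousOn_fst_image {A B Z : Type*} [TopologicalSpace A] [TopologicalSpace B]
    [TopologicalSpace Z] [T2Space A] [T2Space B] {K : Set (A × B)} (hK : IsCompact K)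
    {g : A × B → Z} (hg : ContinuousOn g K) {h : A → Z} (hgh : ∀ q ∈ K, h q.1 = g q) :
    ContinuousOn h (Prod.fst '' K) := by
  rw [continuousOn_iff_isClosed]
  intro t ht
  refine ⟨Prod.fst '' (K ∩ g ⁻¹' t), ((hK.of_isClosed_subset
    (hg.preimage_isClosed_of_isClosed hK.isClosed ht) inter_subset_left).image
      continuous_fst).isClosed, ?_⟩
  ext a
  constructor
  · rintro ⟨ha, q, hq, rfl⟩
    refine ⟨⟨q, ⟨hq, ?_⟩, rfl⟩, q, hq, rfl⟩
    rwa [mem_preimage, ← hgh q hq]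
  · rintro ⟨⟨q, ⟨hq, hqt⟩, rfl⟩, hq'⟩
    refine ⟨?_, hq'⟩
    rwa [mem_preimage, hgh q hq]

theorem exists_compact_nhds_of_locallyCompact {S : Set ℂ} [LocallyCompactSpace S] {T : Set ℂ}
    (hT : IsCompact T) (hTS : T ⊆ S) :
    ∃ K O : Set ℂ, IsCompact K ∧ K ⊆ S ∧ IsOpen O ∧ T ⊆ O ∧ S ∩ O ⊆ K := by
  have h1 : IsCompact (Subtype.val ⁻¹' T : Set S) := by
    rw [Subtype.isCompact_iff, Subtype.image_preimage_coe, inter_eq_right.2 hTS]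
    exact hT
  obtain ⟨K, hK, hTK⟩ := exists_compact_superset h1
  obtain ⟨O, hO, hOK⟩ := isOpen_induced_iff.1 (isOpen_interior (s := K))
  refine ⟨Subtype.val '' K, O, hK.image continuous_subtype_val, Subtype.coe_image_subset _ _, hO,
    fun x hx => ?_, fun x hx => ?_⟩
  · have : (⟨x, hTS hx⟩ : S) ∈ interior K := hTK hx
    rwa [← hOK] at this
  · have : (⟨x, hx.1⟩ : S) ∈ interior K := by
      rw [← hOK]; exact hx.2
    exact ⟨_, interior_subset this, rfl⟩

/-- The nodes are the roots of the minimal, not the characteristic, polynomial: a repeated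
eigenvalue may be isolated in `S`, whereas a multiple root of `minpoly` may not. The price is a
variable number of nodes. -/
theorem exists_repTuple_minpoly {n : ℕ} {S : Set ℂ} {Y : Mat (n + 1)} (hY : Y ∈ matsO (n + 1) S) :
    ∃ m ≤ n, ∃ w ∈ repTuples (m + 1) S, (∀ i, w i ∈ spectrum ℂ Y) ∧
      aeval Y (∏ i, (X - C (w i))) = 0 := by
  classical
  have hint : IsIntegral ℂ Y := Matrix.isIntegral Y
  have hsp := IsAlgClosed.splits (minpoly ℂ Y)
  have hpos : 0 < (minpoly ℂ Y).natDegree := minpoly.natDegree_pos hint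
  have hle : (minpoly ℂ Y).natDegree ≤ n + 1 := by
    have := natDegree_le_of_dvd (Matrix.minpoly_dvd_charpoly Y) (Matrix.charpoly_monic Y).ne_zero
    simpa [Matrix.charpoly_natDegree_eq_dim] using this
  obtain ⟨m, hm⟩ := Nat.exists_eq_add_of_le' hpos
  replace hm : (minpoly ℂ Y).natDegree = m + 1 := hm
  obtain ⟨l, hl⟩ := Quotient.exists_rep (minpoly ℂ Y).roots
  replace hl : (l : Multiset ℂ) = (minpoly ℂ Y).roots := hl
  have hlen : l.length = m + 1 := by
    rw [← Multiset.coe_card, hl, ← hsp.natDegree_eq_card_roots, hm]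
  obtain ⟨w, rfl⟩ : ∃ w : Fin (m + 1) → ℂ, l = List.ofFn w :=
    ⟨fun i => l.get (i.cast hlen.symm), List.ext_get (by simp only [List.length_ofFn, hlen])
      fun i h1 h2 => by rw [List.get_ofFn]; rfl⟩
  have hprod : ∏ i, (X - C (w i)) = minpoly ℂ Y := by
    conv_rhs => rw [hsp.eq_prod_roots_of_monic (minpoly.monic hint), ← hl]
    rw [Multiset.map_coe, List.map_ofFn, Multiset.prod_coe, List.prod_ofFn]
    rfl
  have hspec : ∀ i, w i ∈ spectrum ℂ Y := fun i => by
    refine Matrix.mem_spectrum_of_isRoot_charpoly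
      (IsRoot.dvd (p := minpoly ℂ Y) ?_ (Matrix.minpoly_dvd_charpoly Y))
    rw [← hprod, IsRoot.def, eval_prod]
    exact Finset.prod_eq_zero (Finset.mem_univ i) (by simp)
  refine ⟨m, by omega, w, ⟨fun i => hY.1 (hspec i), fun i j hij h => hY.2 _ ?_⟩, hspec, ?_⟩
  · rw [← hprod, rootMultiplicity_prod_X_sub_C]
    exact Finset.one_lt_card.2 ⟨i, by simp, j, by simp [h], hij⟩
  · rw [hprod, minpoly.aeval]

theorem IsDDC.unifContNear {n : ℕ} {S : Set ℂ} {f : ℂ → ℂ} (hn : 1 ≤ n) (h : IsDDC n S f)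
    [LocallyCompactSpace S] {X : Mat (n + 1)} (hX : X ∈ matsO (n + 1) S) :
    UnifContNear (matFun S f) (matsO (n + 1) S) X := by
  obtain ⟨K, O, hK, hKS, hO, hXO, hOK⟩ :=
    exists_compact_nhds_of_locallyCompact (spectrum.isCompact (𝕜 := ℂ) X) hX.1
  obtain ⟨B, hB, hXB⟩ := exists_compact_mem_nhds X
  -- Upper semicontinuity of the spectrum keeps eigenvalues of nearby matrices in `O`, hence those
  -- lying in `S` in the compact set `K`.
  have hsp : {Y : Mat (n + 1) | spectrum ℂ Y ⊆ O} ∈ 𝓝 X := by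
    filter_upwards [upperHemicontinuous_spectrum ℂ (Mat (n + 1)) X O (hO.mem_nhdsSet.2 hXO)]
      with Y hY using subset_of_mem_nhdsSet hY
  -- The matrices of `B` annihilated by some admissible tuple of `m + 1` nodes in `K`. Each `D m` is
  -- compact, and finitely many of them cover the matrices near `X`.
  set D : Fin (n + 1) → Set (Mat (n + 1)) := fun m => Prod.fst ''
    {q : Mat (n + 1) × (Fin (m + 1) → ℂ) | q ∈ B ×ˢ
      (Set.pi univ (fun _ => K) ∩ closure (distinctTuples (m + 1) S)) ∧
        aeval q.1 (∏ i, (Polynomial.X - C (q.2 i))) = 0} with hD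
  have hrep : ∀ (m : ℕ) (w : Fin (m + 1) → ℂ),
      w ∈ Set.pi univ (fun _ => K) ∩ closure (distinctTuples (m + 1) S) →
      w ∈ repTuples (m + 1) S := fun m w hw =>
    mem_repTuples_of_mem_closure (fun i => hKS (hw.1 i (mem_univ i))) hw.2
  have hcomp : ∀ m : Fin (n + 1), IsCompact {q : Mat (n + 1) × (Fin (m + 1) → ℂ) | q ∈ B ×ˢ
      (Set.pi univ (fun _ => K) ∩ closure (distinctTuples (m + 1) S)) ∧
        aeval q.1 (∏ i, (Polynomial.X - C (q.2 i))) = 0} := fun m => by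
    refine IsCompact.inter_right (hB.prod ((isCompact_univ_pi fun _ => hK).inter_right
      isClosed_closure)) (isClosed_eq ?_ continuous_const)
    exact continuous_aeval_prod_X_sub_C _
  have hDc : ∀ m, IsCompact (D m) := fun m => (hcomp m).image continuous_fst
  have hcont : ∀ m, ContinuousOn (matFun S f) (D m) := fun m => by
    refine continuousOn_fst_image (hcomp m) (g := fun q => aeval q.1 (newton (divDiffExt S f) m q.2))
      ?_ ?_
    · exact (continuousOn_aeval_newton_divDiffExt h (Nat.lt_succ_iff.1 m.2)).mono
        fun q hq => ⟨mem_univ _, hrep _ _ hq.1.2⟩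
    · exact fun q hq => matFun_eq_aeval_newton hn h (Nat.lt_succ_iff.1 m.2) (hrep _ _ hq.1.2) hq.2
  have hU : UniformContinuousOn (matFun S f) (⋃ m, D m) :=
    (isCompact_iUnion hDc).uniformContinuousOn_of_continuous
      ((locallyFinite_of_finite D).continuousOn_iUnion (fun m => (hDc m).isClosed) hcont)
  refine ⟨interior (B ∩ {Y : Mat (n + 1) | spectrum ℂ Y ⊆ O}), isOpen_interior,
    mem_interior_iff_mem_nhds.2 (inter_mem hXB hsp), hU.mono ?_⟩
  rintro Y ⟨hYV, hY⟩
  obtain ⟨hYB, hYO⟩ := interior_subset hYV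
  obtain ⟨m, hm, w, hw, hws, hwY⟩ := exists_repTuple_minpoly hY
  refine mem_iUnion.2 ⟨⟨m, Nat.lt_succ_of_le hm⟩, (Y, w), ⟨⟨hYB, fun i _ => ?_,
    repTuples_subset_closure _ _ hw⟩, hwY⟩, rfl⟩
  exact hOK ⟨hw.1 i, hYO (hws i)⟩

/-! ### Diagonalizable matrices -/

theorem spectrum_conj {k : ℕ} {Q : Mat k} (hQ : IsUnit Q) (A : Mat k) :
    spectrum ℂ (Q * A * Q⁻¹) = spectrum ℂ A := by
  obtain ⟨u, rfl⟩ := hQ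
  rw [← Matrix.coe_units_inv]
  exact spectrum.units_conjugate

theorem minpoly_conj {k : ℕ} {Q : Mat k} (hQ : IsUnit Q) (A : Mat k) :
    minpoly ℂ (Q * A * Q⁻¹) = minpoly ℂ A := by
  obtain ⟨u, rfl⟩ := hQ
  rw [← Matrix.coe_units_inv, ← ConjAct.ofConjAct_toConjAct u, ← ConjAct.units_smul_def]
  exact minpoly.algEquiv_eq (MulSemiringAction.toAlgEquiv ℂ (Mat k) (ConjAct.toConjAct u)) A

theorem rootMultiplicity_minpoly_diagonal_le {k : ℕ} (d : Fin k → ℂ) (a : ℂ) :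
    (minpoly ℂ (Matrix.diagonal d)).rootMultiplicity a ≤ 1 := by
  classical
  set N : ℂ[X] := ∏ x ∈ Finset.univ.image d, (X - C x) with hN
  have hN0 : N ≠ 0 := (monic_prod_of_monic _ _ fun x _ => monic_X_sub_C x).ne_zero
  have hdvd : minpoly ℂ (Matrix.diagonal d) ∣ N := by
    refine minpoly.dvd _ _ ?_
    have h1 : aeval (Matrix.diagonal d) N = Matrix.diagonalAlgHom ℂ (aeval d N) :=
      aeval_algHom_apply (Matrix.diagonalAlgHom ℂ) d N
    have h2 : aeval d N = 0 := by
      ext i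
      have h3 := aeval_algHom_apply (Pi.evalAlgHom ℂ (fun _ : Fin k => ℂ) i) d N
      simp only [Pi.evalAlgHom_apply, coe_aeval_eq_eval] at h3
      rw [← h3, hN, eval_prod, Pi.zero_apply]
      exact Finset.prod_eq_zero (Finset.mem_image_of_mem d (Finset.mem_univ i)) (by simp)
    rw [h1, h2, map_zero]
  refine (rootMultiplicity_le_rootMultiplicity_of_dvd hN0 hdvd a).trans ?_
  rw [← count_roots, hN, roots_prod_X_sub_C]
  exact Multiset.nodup_iff_count_le_one.1 (Finset.univ.image d).nodup a

theorem mem_diagMats_iff {k : ℕ} {S : Set ℂ} {X : Mat k} : X ∈ diagMats k S ↔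
    ∃ (Q : Mat k) (d : Fin k → ℂ), IsUnit Q ∧ (∀ i, d i ∈ S) ∧ X = Q * Matrix.diagonal d * Q⁻¹ := by
  constructor
  · rintro ⟨hS, P, d, hP, hd⟩
    have hdet := (Matrix.isUnit_iff_isUnit_det P).1 hP
    have hX : X = P⁻¹ * Matrix.diagonal d * P⁻¹⁻¹ := by
      rw [← hd, Matrix.nonsing_inv_nonsing_inv P hdet, mul_assoc, mul_assoc, mul_assoc,
        Matrix.nonsing_inv_mul P hdet, mul_one, ← mul_assoc, Matrix.nonsing_inv_mul P hdet, one_mul]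
    have hQ : IsUnit P⁻¹ := Matrix.isUnit_nonsing_inv_iff.2 hP
    refine ⟨P⁻¹, d, hQ, fun i => hS ?_, hX⟩
    rw [hX, spectrum_conj hQ, spectrum_diagonal]
    exact mem_range_self i
  · rintro ⟨Q, d, hQ, hd, rfl⟩
    have hdet := (Matrix.isUnit_iff_isUnit_det Q).1 hQ
    refine ⟨?_, Q⁻¹, d, Matrix.isUnit_nonsing_inv_iff.2 hQ, ?_⟩
    · rw [spectrum_conj hQ, spectrum_diagonal]
      exact range_subset_iff.2 hd
    · rw [Matrix.nonsing_inv_nonsing_inv Q hdet, mul_assoc, mul_assoc, mul_assoc,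
        Matrix.nonsing_inv_mul Q hdet, mul_one, ← mul_assoc, Matrix.nonsing_inv_mul Q hdet, one_mul]

theorem diagMats_subset_matsO {k : ℕ} {S T : Set ℂ} (hST : S ⊆ T) :
    diagMats k S ⊆ matsO k T := by
  intro X hX
  refine ⟨hX.1.trans hST, fun a ha => ?_⟩
  obtain ⟨Q, d, hQ, -, rfl⟩ := mem_diagMats_iff.1 hX
  rw [minpoly_conj hQ] at ha
  exact absurd (rootMultiplicity_minpoly_diagonal_le d a) (by omega)

theorem matFun_congr_of_mem_diagMats {k : ℕ} {S T : Set ℂ} {f g : ℂ → ℂ} (hfg : EqOn g f S)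
    {X : Mat k} (hX : X ∈ diagMats k S) : matFun S f X = matFun T g X := by
  obtain ⟨Q, d, hQ, hd, rfl⟩ := mem_diagMats_iff.1 hX
  rw [matFun_conj_diagonal S f Q hQ, matFun_conj_diagonal T g Q hQ]
  simp only [hfg (hd _)]

theorem scalar_mem_diagMats {k : ℕ} {S : Set ℂ} {z : ℂ} (hz : z ∈ S) :
    Matrix.scalar (Fin k) z ∈ diagMats k S :=
  mem_diagMats_iff.2 ⟨1, fun _ => z, isUnit_one, fun _ => hz, by simp⟩

theorem matFun_scalar {k : ℕ} (S : Set ℂ) (f : ℂ → ℂ) (z : ℂ) :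
    matFun S f (Matrix.scalar (Fin k) z) = Matrix.scalar (Fin k) (f z) := by
  simpa using matFun_conj_diagonal S f (1 : Mat k) isUnit_one fun _ => z

/-! ### Divided differences as entries of functions of bidiagonal matrices -/

/-- The upper bidiagonal matrix with diagonal `w` and constant superdiagonal `e`. -/
def bidiag {k : ℕ} (e : ℂ) (w : Fin k → ℂ) : Mat k :=
  Matrix.diagonal w + Matrix.of fun i j : Fin k => if (i : ℕ) + 1 = j then e else 0

/-- The eigenvectors (as columns) of `bidiag e w`. -/
def bidiagEigen {k : ℕ} (e : ℂ) (w : Fin k → ℂ) : Mat k :=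
  Matrix.of fun i j => (∏ l : Fin k with l < i, (w j - w l)) / e ^ (i : ℕ)

theorem isUnit_bidiagEigen {k : ℕ} {e : ℂ} (he : e ≠ 0) {w : Fin k → ℂ}
    (hw : Function.Injective w) : IsUnit (bidiagEigen e w) := by
  rw [Matrix.isUnit_iff_isUnit_det, Matrix.det_of_isUpperTriangular, isUnit_iff_ne_zero,
    Finset.prod_ne_zero_iff]
  · intro i _
    refine div_ne_zero (Finset.prod_ne_zero_iff.2 fun l hl => sub_ne_zero.2 fun h => ?_)
      (pow_ne_zero _ he)
    exact (Finset.mem_filter.1 hl).2.ne (hw h).symm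
  · intro i j hij
    simp only [bidiagEigen, Matrix.of_apply]
    rw [Finset.prod_eq_zero (i := j) (Finset.mem_filter.2 ⟨Finset.mem_univ _, hij⟩) (sub_self _),
      zero_div]

theorem bidiag_mul_eigen {k : ℕ} {e : ℂ} (he : e ≠ 0) (w : Fin k → ℂ) :
    bidiag e w * bidiagEigen e w = bidiagEigen e w * Matrix.diagonal w := by
  ext i j
  rw [Matrix.mul_diagonal, bidiag, add_mul, Matrix.add_apply, Matrix.diagonal_mul, Matrix.mul_apply]
  simp only [Matrix.of_apply, ite_mul, zero_mul]
  by_cases hi : (i : ℕ) + 1 < k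
  · rw [Finset.sum_eq_single ⟨i + 1, hi⟩ (fun l _ hl => if_neg fun h => hl (Fin.ext h.symm))
      (fun h => absurd (Finset.mem_univ _) h), if_pos rfl]
    have hs : (Finset.univ.filter fun l : Fin k => l < ⟨i + 1, hi⟩) =
        insert i (Finset.univ.filter fun l : Fin k => l < i) := by
      ext l
      simp only [Finset.mem_filter, Finset.mem_univ, true_and, Finset.mem_insert, Fin.lt_def,
        Fin.ext_iff]
      omega
    simp only [bidiagEigen, Matrix.of_apply]
    rw [hs, Finset.prod_insert (by simp)]
    field_simp
    ring
  -- The last row has no superdiagonal entry, and there the eigenvector matrix vanishes off the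
  -- diagonal.
  · rw [Finset.sum_eq_zero fun l _ => if_neg (by omega), add_zero]
    rcases eq_or_ne j i with rfl | hji
    · ring
    · have hlt : j < i := lt_of_le_of_ne (Fin.le_def.2 (by omega)) hji
      simp only [bidiagEigen, Matrix.of_apply]
      rw [Finset.prod_eq_zero (i := j) (Finset.mem_filter.2 ⟨Finset.mem_univ _, hlt⟩) (sub_self _)]
      simp

/-- The products appearing here are, up to powers of `e`, the entries of `bidiagEigen`. -/
theorem eval_newton (F : (n : ℕ) → (Fin (n + 1) → ℂ) → ℂ) (x : ℂ) : ∀ (m : ℕ)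
    (w : Fin (m + 1) → ℂ), (newton F m w).eval x = ∑ j : Fin (m + 1),
      F j (fun i => w (i.castLE (Nat.succ_le_of_lt j.2))) * ∏ l with l < j, (x - w l) := by
  intro m
  induction m with
  | zero => intro w; simp [newton]
  | succ m ih =>
    intro w
    rw [newton, eval_add, Fin.sum_univ_castSucc, ih]
    congr 1
    · refine Finset.sum_congr rfl fun j _ => ?_
      congr 1
      rw [Finset.prod_filter, Finset.prod_filter,
        Fin.prod_univ_castSucc (fun a : Fin (m + 1 + 1) => if a < j.castSucc then x - w a else 1)]
      simp [not_lt.2 (Fin.le_last _)]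
    · rw [Finset.prod_filter, Fin.prod_univ_castSucc
        (fun a : Fin (m + 1 + 1) => if a < Fin.last (m + 1) then x - w a else 1)]
      simp [eval_prod, Fin.castSucc_lt_last]

theorem bidiag_mem_diagMats {k : ℕ} {S : Set ℂ} {e : ℂ} (he : e ≠ 0) {w : Fin k → ℂ}
    (hw : w ∈ distinctTuples k S) : bidiag e w ∈ diagMats k S := by
  have hU := isUnit_bidiagEigen he hw.2
  refine mem_diagMats_iff.2 ⟨bidiagEigen e w, w, hU, hw.1, ?_⟩
  rw [← bidiag_mul_eigen he, Matrix.mul_nonsing_inv_cancel_right _ _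
    ((Matrix.isUnit_iff_isUnit_det _).1 hU)]

/-- Row `0` of the eigenvector matrix consists of ones, so row `0` of `f[X]` times that matrix is
`(f (w i))`. By Newton's formula the row `r` of scaled divided differences has the same product, and
the matrix is invertible. -/
theorem matFun_bidiag_apply {n : ℕ} (S : Set ℂ) (f : ℂ → ℂ) {e : ℂ} (he : e ≠ 0)
    {w : Fin (n + 1) → ℂ} (hw : Function.Injective w) :
    matFun S f (bidiag e w) 0 (Fin.last n) = e ^ n * divDiff f n w := by
  have hU := isUnit_bidiagEigen he hw
  have hdet := (Matrix.isUnit_iff_isUnit_det _).1 hU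
  have hX : bidiag e w = bidiagEigen e w * Matrix.diagonal w * (bidiagEigen e w)⁻¹ := by
    rw [← bidiag_mul_eigen he, Matrix.mul_nonsing_inv_cancel_right _ _ hdet]
  have hM : matFun S f (bidiag e w) * bidiagEigen e w =
      bidiagEigen e w * Matrix.diagonal fun i => f (w i) := by
    rw [hX, matFun_conj_diagonal S f _ hU, Matrix.nonsing_inv_mul_cancel_right _ _ hdet]
  set r : Fin (n + 1) → ℂ := fun j =>
    e ^ (j : ℕ) * divDiff f j (fun i => w (i.castLE (Nat.succ_le_of_lt j.2))) with hr
  have h1 : Matrix.vecMul r (bidiagEigen e w) = fun i => f (w i) := by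
    ext i
    rw [← eval_newton_node_of_injective f n w hw i, eval_newton, Matrix.vecMul, dotProduct]
    refine Finset.sum_congr rfl fun j _ => ?_
    simp only [hr, bidiagEigen, Matrix.of_apply]
    have := pow_ne_zero (j : ℕ) he
    field_simp
  have h2 : Matrix.vecMul (matFun S f (bidiag e w) 0) (bidiagEigen e w) = fun i => f (w i) := by
    ext i
    change (matFun S f (bidiag e w) * bidiagEigen e w) 0 i = _
    rw [hM, Matrix.mul_diagonal]
    simp [bidiagEigen]
  have h4 := Matrix.vecMul_injective_of_isUnit hU (h2.trans h1.symm)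
  rw [h4, hr]
  rfl

/-! ### Extension of a function whose functional calculus is locally uniformly continuous -/

theorem bidiag_zero_const {k : ℕ} (x : ℂ) :
    bidiag 0 (fun _ => x) = Matrix.scalar (Fin k) x := by
  ext i j
  simp [bidiag]

theorem continuous_bidiag (k : ℕ) :
    Continuous fun q : ℂ × (Fin k → ℂ) => bidiag q.1 q.2 := by
  refine continuous_matrix fun i j => ?_
  simp only [bidiag, Matrix.add_apply, Matrix.diagonal_apply, Matrix.of_apply]
  split_ifs <;> fun_prop

theorem uniformContinuous_bidiag {k : ℕ} (e : ℂ) :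
    UniformContinuous fun w : Fin k → ℂ => (bidiag e w : Mat k) := by
  refine UniformContinuous.add ?_ uniformContinuous_const
  exact (Matrix.diagonalLinearMap (Fin k) ℂ ℂ).toContinuousLinearMap.uniformContinuous

theorem uniformContinuous_entry {k : ℕ} (i j : Fin k) :
    UniformContinuous fun A : Mat k => A i j :=
  (Matrix.entryLinearMap ℂ ℂ i j).toContinuousLinearMap.uniformContinuous

theorem UnifContNear.exists_ball {n : ℕ} {S : Set ℂ} {f : ℂ → ℂ} {z : ℂ}
    (h : UnifContNear (matFun S f) (diagMats (n + 1) S) (Matrix.scalar (Fin (n + 1)) z)) :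
    ∃ r > 0, UniformContinuousOn f (Metric.ball z r ∩ S) ∧
      UniformContinuousOn (divDiff f n)
        (Metric.ball (fun _ => z) r ∩ distinctTuples (n + 1) S) := by
  obtain ⟨V, hV, hzV, hU⟩ := h
  have hmem : (fun q : ℂ × (Fin (n + 1) → ℂ) => bidiag q.1 q.2) ⁻¹' V ∈ 𝓝 (0, fun _ => z) :=
    (continuous_bidiag _).continuousAt.preimage_mem_nhds (hV.mem_nhds (by rwa [bidiag_zero_const]))
  obtain ⟨r, hr, hrV⟩ := Metric.mem_nhds_iff.1 hmem
  have hball : ∀ e : ℂ, ‖e‖ < r → ∀ w ∈ Metric.ball (fun _ : Fin (n + 1) => z) r,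
      bidiag e w ∈ V := by
    intro e he w hw
    refine hrV (a := (e, w)) ?_
    rw [← ball_prod_same]
    exact ⟨by simpa using he, hw⟩
  refine ⟨r, hr, ?_, ?_⟩
  · have h1 : UniformContinuousOn
        (fun x : ℂ => matFun S f (bidiag 0 fun _ : Fin (n + 1) => x) 0 0) (Metric.ball z r ∩ S) := by
      refine (uniformContinuous_entry 0 0).comp_uniformContinuousOn (hU.comp
        (((uniformContinuous_bidiag 0).comp
          (uniformContinuous_pi.2 fun _ => uniformContinuous_id)).uniformContinuousOn) ?_)
      rintro x ⟨hx, hxS⟩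
      refine ⟨hball 0 (by simpa using hr) _ ?_, ?_⟩
      · rw [Metric.mem_ball, dist_pi_lt_iff hr]
        exact fun _ => hx
      · change bidiag 0 (fun _ => x) ∈ diagMats (n + 1) S
        rw [bidiag_zero_const]
        exact scalar_mem_diagMats hxS
    refine h1.congr fun x _ => ?_
    simp only [bidiag_zero_const, matFun_scalar]
    simp
  -- A fixed nonzero `e`, small enough to stay in `V`; since it does not vary, dividing by `e ^ n`
  -- preserves uniform continuity.
  · set e : ℂ := ((r / 2 : ℝ) : ℂ) with he
    have he0 : e ≠ 0 := by
      rw [he, Complex.ofReal_ne_zero]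
      positivity
    have her : ‖e‖ < r := by
      rw [he, Complex.norm_real, Real.norm_of_nonneg (by positivity)]
      linarith
    have h1 : UniformContinuousOn
        (fun w : Fin (n + 1) → ℂ => (e ^ n)⁻¹ • matFun S f (bidiag e w) 0 (Fin.last n))
        (Metric.ball (fun _ => z) r ∩ distinctTuples (n + 1) S) := by
      refine (uniformContinuous_id.const_smul (e ^ n)⁻¹).comp_uniformContinuousOn
        ((uniformContinuous_entry 0 (Fin.last n)).comp_uniformContinuousOn (hU.comp
        (uniformContinuous_bidiag e).uniformContinuousOn ?_))
      exact fun w hw => ⟨hball e her w hw.1, bidiag_mem_diagMats he0 hw.2⟩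
    refine h1.congr fun w hw => ?_
    simp only [matFun_bidiag_apply S f he0 hw.2.2, smul_eq_mul]
    exact inv_mul_cancel_left₀ (pow_ne_zero _ he0) _

/-- Injectivity is an open condition on tuples, so approximation by arbitrary tuples from `S`
suffices. -/
theorem distinctTuples_subset_closure {m : ℕ} {S T : Set ℂ} (h : T ⊆ closure S) :
    distinctTuples m T ⊆ closure (distinctTuples m S) := by
  have hopen : IsOpen {w : Fin m → ℂ | Function.Injective w} := by
    have : {w : Fin m → ℂ | Function.Injective w} =
        ⋂ i : Fin m, ⋂ j : Fin m, {w | i ≠ j → w i ≠ w j} := by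
      ext w
      simp only [mem_ofPred_eq, mem_iInter]
      exact ⟨fun h i j hij => h.ne hij, fun h i j hij => not_not.1 fun hne => h i j hne hij⟩
    rw [this]
    refine isOpen_iInter_of_finite fun i => isOpen_iInter_of_finite fun j => ?_
    by_cases hij : i = j
    · simp [hij]
    · simpa [hij] using isOpen_ne_fun (continuous_apply i) (continuous_apply j)
  intro w hw
  have h1 : w ∈ closure (Set.pi univ fun _ : Fin m => S) := by
    rw [closure_pi_set]
    exact fun i _ => h (hw.1 i)
  refine closure_mono ?_ (hopen.inter_closure ⟨hw.2, h1⟩)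
  exact fun v hv => ⟨fun i => hv.2 i (mem_univ i), hv.1⟩

theorem exists_isDDC_extension {n : ℕ} {S : Set ℂ} {f : ℂ → ℂ}
    (h : ∀ z ∈ S, UnifContNear (matFun S f) (diagMats (n + 1) S) (Matrix.scalar (Fin (n + 1)) z)) :
    ∃ (T : Set ℂ) (g : ℂ → ℂ), LocallyCompactSpace T ∧ S ⊆ T ∧ T ⊆ closure S ∧
      EqOn g f S ∧ IsDDC n T g := by
  choose! r hr hf hd using fun z hz => (h z hz).exists_ball
  -- Closed intersected with open, hence locally compact, and every point of `T` lies in a ball of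
  -- uniform continuity.
  set T : Set ℂ := closure S ∩ ⋃ z ∈ S, Metric.ball z (r z) with hT
  have hST : S ⊆ T := fun z hz =>
    ⟨subset_closure hz, mem_biUnion hz (Metric.mem_ball_self (hr z hz))⟩
  have hTS : T ⊆ closure S := inter_subset_left
  have hlim : ∀ b ∈ T, ∃ y, Tendsto f (𝓝[S] b) (𝓝 y) := by
    rintro b ⟨hbS, hb⟩
    obtain ⟨z, hz, hbz⟩ := mem_iUnion₂.1 hb
    have hne : NeBot (𝓝[S] b) := mem_closure_iff_nhdsWithin_neBot.1 hbS
    refine CompleteSpace.complete ((cauchy_nhds.mono nhdsWithin_le_nhds).map_of_le (hf z hz) ?_)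
    exact le_principal_iff.2 (inter_mem (mem_nhdsWithin_of_mem_nhds (Metric.isOpen_ball.mem_nhds hbz))
      self_mem_nhdsWithin)
  set g : ℂ → ℂ := extendFrom S f with hg
  have hgc : ContinuousOn g T := continuousOn_extendFrom hTS hlim
  have hgf : EqOn g f S := by
    intro z hz
    obtain ⟨y, hy⟩ := hlim z (hST hz)
    refine extendFrom_eq (subset_closure hz) ?_
    rwa [tendsto_nhds_unique (tendsto_pure_nhds f z) (hy.mono_left (pure_le_nhdsWithin hz))]
  refine ⟨T, g, (isClosed_closure.isLocallyClosed.inter (isOpen_biUnion fun z _ =>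
    Metric.isOpen_ball).isLocallyClosed).locallyCompactSpace, hST, hTS, hgf, fun b hb => ?_⟩
  have hdense := distinctTuples_subset_closure (m := n + 1) hTS
  have hne : NeBot (𝓝[distinctTuples (n + 1) S] (fun _ => b)) :=
    mem_closure_iff_nhdsWithin_neBot.1 (closure_minimal hdense isClosed_closure
      (repTuples_subset_closure _ _ (const_mem_repTuples hb)))
  obtain ⟨z, hz, hbz⟩ := mem_iUnion₂.1 hb.1.2
  obtain ⟨L, hL⟩ : ∃ L, Tendsto (divDiff f n) (𝓝[distinctTuples (n + 1) S] (fun _ => b)) (𝓝 L) := by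
    refine CompleteSpace.complete ((cauchy_nhds.mono nhdsWithin_le_nhds).map_of_le (hd z hz) ?_)
    refine le_principal_iff.2 (inter_mem (mem_nhdsWithin_of_mem_nhds
      (Metric.isOpen_ball.mem_nhds ?_)) self_mem_nhdsWithin)
    rw [Metric.mem_ball, dist_pi_lt_iff (hr z hz)]
    exact fun _ => hbz
  have hdd : EqOn (divDiff g n) (divDiff f n) (distinctTuples (n + 1) S) := by
    intro w hw
    exact divDiff_congr fun i => hgf (hw.1 i)
  -- The limit along tuples from `S` is also the limit along tuples from `T`: the former are dense,
  -- `divDiff g n` is continuous at distinct tuples, and closed neighbourhoods of `L` keep limits.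
  refine ⟨L, (closed_nhds_basis L).tendsto_right_iff.2 fun N hN => ?_⟩
  obtain ⟨O, hO, hbO, hON⟩ := mem_nhdsWithin.1 (hL hN.1)
  refine mem_nhdsWithin.2 ⟨O, hO, hbO, fun w hw => ?_⟩
  have hneW : NeBot (𝓝[distinctTuples (n + 1) S] w) :=
    mem_closure_iff_nhdsWithin_neBot.1 (hdense hw.2)
  have hsub : distinctTuples (n + 1) S ⊆ distinctTuples (n + 1) T :=
    fun v hv => ⟨fun i => hST (hv.1 i), hv.2⟩
  refine hN.2.mem_of_tendsto ((continuousOn_divDiff hgc n w hw.2).mono hsub) ?_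
  filter_upwards [mem_nhdsWithin_of_mem_nhds (hO.mem_nhds hw.1), self_mem_nhdsWithin] with v hv hvd
  rw [hdd hvd]
  exact hON ⟨hv, hvd⟩

end MatCalc

end

open MatCalc
theorem proposition5p8 (Ω : Set ℂ) (hΩ : Ω.Nonempty) (f : ℂ → ℂ) (k : ℕ) (hk : 2 ≤ k) :
    List.TFAE [
      ∀ z ∈ Ω, UnifContNear (matFun Ω f) (diagMats k Ω) (Matrix.scalar (Fin k) z),
      ∀ X ∈ diagMats k Ω, UnifContNear (matFun Ω f) (diagMats k Ω) X,
      ∃ (Ω₁ : Set ℂ) (f₁ : ℂ → ℂ), LocallyCompactSpace Ω₁ ∧ Ω ⊆ Ω₁ ∧ Ω₁ ⊆ closure Ω ∧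
        Set.EqOn f₁ f Ω ∧ IsDDC (k - 1) Ω₁ f₁] ∧
    ∀ (Ω₁ : Set ℂ) (f₁ : ℂ → ℂ), LocallyCompactSpace Ω₁ → Ω ⊆ Ω₁ → Ω₁ ⊆ closure Ω →
      Set.EqOn f₁ f Ω → IsDDC (k - 1) Ω₁ f₁ →
      IsTC (k - 1) Ω₁ f₁ ∧
      ∀ X ∈ matsO k Ω₁, UnifContNear (matFun Ω₁ f₁) (matsO k Ω₁) X := by
  obtain ⟨n, rfl⟩ : ∃ n, k = n + 1 := ⟨k - 1, by omega⟩
  have hn : 1 ≤ n := by omega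
  simp only [Nat.add_sub_cancel]
  refine ⟨?_, fun S g hS _ _ _ h => ⟨h.isTC hn, fun X hX => h.unifContNear hn hX⟩⟩
  tfae_have 2 → 1 := fun h z hz => h _ (scalar_mem_diagMats hz)
  tfae_have 1 → 3 := exists_isDDC_extension
  tfae_have 3 → 2 := by
    rintro ⟨S, g, hS, hΩS, -, hgf, h⟩ X hX
    obtain ⟨V, hV, hXV, hU⟩ := h.unifContNear hn (diagMats_subset_matsO hΩS hX)
    exact ⟨V, hV, hXV, (hU.mono (inter_subset_inter_right V (diagMats_subset_matsO hΩS))).congr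
      fun Y hY => (matFun_congr_of_mem_diagMats hgf hY.2).symm⟩
  tfae_finish
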